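/- Let $k,l\ge 0$, $n=k+l$, and let $X$ be the Grassmannian of $k$-dimensional subspaces of $\mathbb C^{n}$ (with standard basis $\mathbf e_1,\dots,\mathbf e_n$), with the action of the Borel subgroup $B\subset SL(n,\mathbb C)$ of upper triangular matrices. Let $\lambda=(\lambda_1\ge\dots\ge\lambda_k\ge 0)$ be a partition with $\lambda_1\le l$, let $W=W_\lambda\in X$ be the span of the vectors $\mathbf e_i$ for $i\in\{\lambda_k+1,\lambda_{k-1}+2,\dots,\lambda_1+k\}$, and let $X_\lambda=B\cdot W_\lambda$ be the corresponding Schubert cell. Identify $T_WX=\operatorname{Hom}(W,\mathbb C^n/W)$ and $T^*_WX=\operatorname{Hom}(\mathbb C^n/W,W)$, the pairing being the trace, and let $$M_\lambda=T^*_WX\cap T^*_{X_\lambda}X=\{A\in \operatorname{Hom}(\mathbb C^n/W,W)\;:\; A \text{ annihilates } T_WX_\lambda\}$$ be the fiber at $W$ of the conormal bundle of $X_\lambda$. The stabilizer $B_\lambda\subset B$ of $W$ acts linearly on $M_\lambda$ by $g\cdot A=g_1Ag_2^{-1}$, where $g_1$ and $g_2$ are the automorphisms of $W$ and of $\mathbb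 C^n/W$ induced by $g$. Codimensions of orbits are complex codimensions in $M_\lambda$. Let $O\subset M_\lambda$ be a $B_\lambda$-orbit of codimension two. Then: 1. There are either exactly one or exactly two $B_\lambda$-orbits of codimension one in $M_\lambda$ whose closures contain $O$. 2. The closure of each of these codimension-one orbits is smooth (a complex submanifold of codimension one in $M_\lambda$) near every point of $O$. 3. If there are two of them, $O_1\neq O_2$, then $\overline{O_1}$ and $\overline{O_2}$ intersect transversely at every point $p\in O$, i.e. $T_p\overline{O_1}+T_p\overline{O_2}=M_\lambda$; thus $\overline{O_1}\cup\overline{O_2}$ has normal crossings at $p$: there are local holomorphic coordinates $x_1,x_2,\dots$ of $M_\lambda$ around $p$ in which $\overline{O_1}=\{x_1=0\}$ and $\overline{O_2}=\{x_2=0\}$. -/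

import Mathlib

open Topology

noncomputable section

namespace GrassmannConormal

/-- `lam` is a partition whose Young diagram fits in a rectangle with `k` rows and `l` columns
(rows and columns are numbered from `0`, as in `YoungDiagram`). -/
def FitsIn (k l : ℕ) (lam : YoungDiagram) : Prop :=
  ∀ c ∈ lam, c.1 < k ∧ c.2 < l

/-- The Borel subgroup of upper triangular matrices in `SL(n, ℂ)`. -/
def borel (n : ℕ) : Subgroup (Matrix.SpecialLinearGroup (Fin n) ℂ) where
  carrier := {g | (g : Matrix (Fin n) (Fin n) ℂ).BlockTriangular id}
  mul_mem' := by
    intro a b ha hb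
    simpa using Matrix.BlockTriangular.mul ha hb
  one_mem' := by
    simpa using Matrix.blockTriangular_one
  inv_mem' := by
    intro a ha
    have h1 : ((a⁻¹ : Matrix.SpecialLinearGroup (Fin n) ℂ) : Matrix (Fin n) (Fin n) ℂ)
        = (a : Matrix (Fin n) (Fin n) ℂ)⁻¹ := by
      refine (Matrix.inv_eq_right_inv ?_).symm
      rw [← Matrix.SpecialLinearGroup.coe_mul, mul_inv_cancel, Matrix.SpecialLinearGroup.coe_one]
    have h2 : Invertible (a : Matrix (Fin n) (Fin n) ℂ) :=
      Matrix.invertibleOfIsUnitDet _ (by simp)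
    change Matrix.BlockTriangular _ id
    rw [h1]
    exact Matrix.blockTriangular_inv_of_blockTriangular ha

/-- The Lie algebra of the Borel subgroup: upper triangular matrices of trace zero. -/
def borelLie (n : ℕ) : Submodule ℂ (Matrix (Fin n) (Fin n) ℂ) where
  carrier := {b | b.BlockTriangular id ∧ b.trace = 0}
  add_mem' := by
    rintro a b ⟨ha, ha'⟩ ⟨hb, hb'⟩
    exact ⟨ha.add hb, by simp [Matrix.trace_add, ha', hb']⟩
  zero_mem' := ⟨Matrix.blockTriangular_zero, Matrix.trace_zero _ _⟩
  smul_mem' := by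
    rintro c a ⟨ha, ha'⟩
    exact ⟨fun i j hij => by simp [ha hij], by simp [Matrix.trace_smul, ha']⟩

/-- The set of indices `I`. With rows and basis vectors numbered from `1` it is
`{lam_k + 1, lam_{k-1} + 2, …, lam_1 + k}`; here both are numbered from `0`. -/
def indexSet (k l : ℕ) (lam : YoungDiagram) : Set (Fin (k + l)) :=
  {m | ∃ i < k, (m : ℕ) + i + 1 = lam.rowLen i + k}

/-- The torus-fixed point `W_lam` of the Schubert cell `X_lam` in the Grassmannian of
`k`-dimensional subspaces of `ℂ^(k+l)`. -/
def fixedPoint (k l : ℕ) (lam : YoungDiagram) : Submodule ℂ (Fin (k + l) → ℂ) :=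
  Submodule.span ℂ ((fun m => Pi.single m (1 : ℂ)) '' indexSet k l lam)

/-- `B_lam`, the stabilizer of the subspace `W_lam` in the Borel subgroup. -/
def borelStab (k l : ℕ) (lam : YoungDiagram) :
    Subgroup (Matrix.SpecialLinearGroup (Fin (k + l)) ℂ) where
  carrier := {g | g ∈ borel (k + l) ∧
    (fixedPoint k l lam).map (Matrix.toLin' (g : Matrix (Fin (k + l)) (Fin (k + l)) ℂ))
      = fixedPoint k l lam}
  mul_mem' := by
    rintro a b ⟨ha, ha'⟩ ⟨hb, hb'⟩
    refine ⟨mul_mem ha hb, ?_⟩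
    rw [Matrix.SpecialLinearGroup.coe_mul, Matrix.toLin'_mul, Submodule.map_comp, hb', ha']
  one_mem' := ⟨one_mem _, by simp⟩
  inv_mem' := by
    rintro a ⟨ha, ha'⟩
    refine ⟨inv_mem ha, ?_⟩
    nth_rewrite 1 [← ha']
    rw [← Submodule.map_comp, ← Matrix.toLin'_mul, ← Matrix.SpecialLinearGroup.coe_mul,
      inv_mul_cancel]
    simp

/-- The fibre `M_lam` over `W = W_lam` of the conormal bundle to the Schubert cell
`X_lam = B W`.

The cotangent space of the Grassmannian at `W` is `Hom(ℂ^n / W, W)`, i.e. the space of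
endomorphisms `A` of `ℂ^n` that vanish on `W` and have image in `W`. It is dual to the tangent
space `Hom(W, ℂ^n / W)` through the trace: if `v` is the tangent vector `W → ℂ^n → ℂ^n / W`
induced by a matrix `b`, then `⟨A, v⟩ = tr (A b)`. The tangent space of the orbit `B W` is the
image of the Lie algebra of `B` under the infinitesimal action, so `A` is conormal to `X_lam`
iff `tr (A b) = 0` for all `b` in this Lie algebra. -/
def conormalMatrices (k l : ℕ) (lam : YoungDiagram) :
    Submodule ℂ (Matrix (Fin (k + l)) (Fin (k + l)) ℂ) where
  carrier := {A | (∀ w ∈ fixedPoint k l lam, A.mulVec w = 0) ∧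
    (∀ v, A.mulVec v ∈ fixedPoint k l lam) ∧
    ∀ b ∈ borelLie (k + l), (A * b).trace = 0}
  add_mem' := by
    rintro A A' ⟨h1, h2, h3⟩ ⟨h1', h2', h3'⟩
    refine ⟨fun w hw => ?_, fun v => ?_, fun b hb => ?_⟩
    · rw [Matrix.add_mulVec, h1 w hw, h1' w hw, add_zero]
    · rw [Matrix.add_mulVec]
      exact add_mem (h2 v) (h2' v)
    · rw [add_mul, Matrix.trace_add, h3 b hb, h3' b hb, add_zero]
  zero_mem' := ⟨by simp, by simp, by simp⟩
  smul_mem' := by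
    rintro c A ⟨h1, h2, h3⟩
    refine ⟨fun w hw => ?_, fun v => ?_, fun b hb => ?_⟩
    · rw [Matrix.smul_mulVec, h1 w hw, smul_zero]
    · rw [Matrix.smul_mulVec]
      exact Submodule.smul_mem _ c (h2 v)
    · rw [smul_mul_assoc, Matrix.trace_smul, h3 b hb, smul_zero]

/-- `M_lam` as a normed space: the elements of `conormalMatrices` are regarded as families of
complex numbers (with the sup norm), since Mathlib has no default norm on matrices. -/
def conormalFiber (k l : ℕ) (lam : YoungDiagram) :
    Submodule ℂ (Fin (k + l) → Fin (k + l) → ℂ) :=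
  (conormalMatrices k l lam).comap (Matrix.ofLinearEquiv ℂ).toLinearMap

theorem mulVec_mem_fixedPoint {k l : ℕ} {lam : YoungDiagram}
    {g : Matrix.SpecialLinearGroup (Fin (k + l)) ℂ} (hg : g ∈ borelStab k l lam)
    {w : Fin (k + l) → ℂ} (hw : w ∈ fixedPoint k l lam) :
    (g : Matrix (Fin (k + l)) (Fin (k + l)) ℂ).mulVec w ∈ fixedPoint k l lam := by
  have h := Submodule.mem_map_of_mem
    (f := Matrix.toLin' (g : Matrix (Fin (k + l)) (Fin (k + l)) ℂ)) hw
  rw [hg.2] at h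
  simpa using h

theorem conj_mem_conormalMatrices {k l : ℕ} {lam : YoungDiagram}
    {g : Matrix.SpecialLinearGroup (Fin (k + l)) ℂ} (hg : g ∈ borelStab k l lam)
    {A : Matrix (Fin (k + l)) (Fin (k + l)) ℂ} (hA : A ∈ conormalMatrices k l lam) :
    (g : Matrix (Fin (k + l)) (Fin (k + l)) ℂ) * A *
      ((g⁻¹ : Matrix.SpecialLinearGroup (Fin (k + l)) ℂ) :
        Matrix (Fin (k + l)) (Fin (k + l)) ℂ) ∈ conormalMatrices k l lam := by
  obtain ⟨h1, h2, h3⟩ := hA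
  have hg' := inv_mem hg
  have hinv : (g : Matrix (Fin (k + l)) (Fin (k + l)) ℂ) *
      ((g⁻¹ : Matrix.SpecialLinearGroup (Fin (k + l)) ℂ) :
        Matrix (Fin (k + l)) (Fin (k + l)) ℂ) = 1 := by
    rw [← Matrix.SpecialLinearGroup.coe_mul, mul_inv_cancel, Matrix.SpecialLinearGroup.coe_one]
  refine ⟨fun w hw => ?_, fun v => ?_, fun b hb => ?_⟩
  · rw [← Matrix.mulVec_mulVec, ← Matrix.mulVec_mulVec, h1 _ (mulVec_mem_fixedPoint hg' hw),
      Matrix.mulVec_zero]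
  · rw [← Matrix.mulVec_mulVec, ← Matrix.mulVec_mulVec]
    exact mulVec_mem_fixedPoint hg (h2 _)
  · rw [Matrix.trace_mul_comm, ← mul_assoc, ← mul_assoc, Matrix.trace_mul_comm,
      ← mul_assoc, Matrix.trace_mul_comm]
    refine h3 _ ⟨?_, ?_⟩
    · exact (Matrix.BlockTriangular.mul hg'.1 (Matrix.BlockTriangular.mul hb.1 hg.1))
    · rw [Matrix.trace_mul_comm, mul_assoc, hinv, mul_one]
      exact hb.2

/-- The action of `B_lam` on `M_lam`. An element `g` acts by `A ↦ g₁ A g₂⁻¹`, where `g₁` and `g₂`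
are the maps induced by `g` on `W` and `ℂ^n / W`; viewing `A` as an endomorphism of `ℂ^n`,
this is `g A g⁻¹`. -/
instance conormalAction (k l : ℕ) (lam : YoungDiagram) :
    MulAction (borelStab k l lam) (conormalFiber k l lam) where
  smul g A := ⟨Matrix.of.symm ((g.1 : Matrix (Fin (k + l)) (Fin (k + l)) ℂ) * Matrix.of A.1 *
    ((g.1⁻¹ : Matrix.SpecialLinearGroup (Fin (k + l)) ℂ) :
      Matrix (Fin (k + l)) (Fin (k + l)) ℂ)), conj_mem_conormalMatrices g.2 A.2⟩
  one_smul A := by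
    apply Subtype.ext
    change Matrix.of.symm (((1 : Matrix.SpecialLinearGroup (Fin (k + l)) ℂ) :
      Matrix (Fin (k + l)) (Fin (k + l)) ℂ) * Matrix.of A.1 *
      (((1 : Matrix.SpecialLinearGroup (Fin (k + l)) ℂ)⁻¹ :
        Matrix.SpecialLinearGroup (Fin (k + l)) ℂ) : Matrix (Fin (k + l)) (Fin (k + l)) ℂ)) = A.1
    rw [inv_one, Matrix.SpecialLinearGroup.coe_one, one_mul, mul_one, Equiv.symm_apply_apply]
  mul_smul g h A := by
    apply Subtype.ext
    change Matrix.of.symm (((g.1 * h.1 : Matrix.SpecialLinearGroup (Fin (k + l)) ℂ) :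
      Matrix (Fin (k + l)) (Fin (k + l)) ℂ) * Matrix.of A.1 *
      (((g.1 * h.1)⁻¹ : Matrix.SpecialLinearGroup (Fin (k + l)) ℂ) :
        Matrix (Fin (k + l)) (Fin (k + l)) ℂ)) =
      Matrix.of.symm ((g.1 : Matrix (Fin (k + l)) (Fin (k + l)) ℂ) *
        Matrix.of (Matrix.of.symm ((h.1 : Matrix (Fin (k + l)) (Fin (k + l)) ℂ) * Matrix.of A.1 *
        ((h.1⁻¹ : Matrix.SpecialLinearGroup (Fin (k + l)) ℂ) :
          Matrix (Fin (k + l)) (Fin (k + l)) ℂ))) *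
        ((g.1⁻¹ : Matrix.SpecialLinearGroup (Fin (k + l)) ℂ) :
          Matrix (Fin (k + l)) (Fin (k + l)) ℂ))
    rw [mul_inv_rev, Matrix.SpecialLinearGroup.coe_mul, Matrix.SpecialLinearGroup.coe_mul,
      Equiv.apply_symm_apply]
    simp only [mul_assoc]

/-- `O` is a `B_lam`-orbit in `M_lam`. -/
def IsOrbit {k l : ℕ} {lam : YoungDiagram} (O : Set (conormalFiber k l lam)) : Prop :=
  ∃ A : conormalFiber k l lam, O = MulAction.orbit (borelStab k l lam) A

section Submanifolds

variable {E : Type*} [NormedAddCommGroup E] [NormedSpace ℂ E]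

/-- Near its point `p`, the set `Z` is a smooth complex submanifold of codimension `c`: it is
cut out by `c` holomorphic equations whose differentials at `p` are linearly independent. -/
def IsSmoothAt (Z : Set E) (c : ℕ) (p : E) : Prop :=
  p ∈ Z ∧ ∃ f : E → (Fin c → ℂ), AnalyticAt ℂ f p ∧ Function.Surjective (fderiv ℂ f p) ∧
    ∀ᶠ x in 𝓝 p, x ∈ Z ↔ f x = 0

/-- `Z` is a (locally closed) complex submanifold of codimension `c`. -/
def HasCodim (Z : Set E) (c : ℕ) : Prop :=
  ∀ p ∈ Z, IsSmoothAt Z c p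

/-- The tangent space at `p`, as a linear subspace, of a set that is smooth at `p`. -/
def tangentSpaceAt (Z : Set E) (p : E) : Submodule ℂ E :=
  Submodule.span ℂ (tangentConeAt ℂ Z p)

/-- The tangent spaces of `Z₁` and `Z₂` at `p` span the ambient space. -/
def TransverseAt (Z₁ Z₂ : Set E) (p : E) : Prop :=
  tangentSpaceAt Z₁ p ⊔ tangentSpaceAt Z₂ p = ⊤

/-- `Z₁` and `Z₂` are hypersurfaces with normal crossings at `p`: in suitable local holomorphic
coordinates `x₁, x₂, …` around `p` they are given by `x₁ = 0` and `x₂ = 0`. -/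
def NormalCrossingsAt (Z₁ Z₂ : Set E) (p : E) : Prop :=
  p ∈ Z₁ ∧ p ∈ Z₂ ∧
  ∃ f : E → (Fin 2 → ℂ), AnalyticAt ℂ f p ∧ Function.Surjective (fderiv ℂ f p) ∧
    ∀ᶠ x in 𝓝 p, (x ∈ Z₁ ↔ f x 0 = 0) ∧ (x ∈ Z₂ ↔ f x 1 = 0)

end Submanifolds

/-- The set of codimension one orbits whose closure contains `O`. -/
def codimOneOrbitsAbove {k l : ℕ} {lam : YoungDiagram} (O : Set (conormalFiber k l lam)) :
    Set (Set (conormalFiber k l lam)) :=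
  {O' | IsOrbit O' ∧ HasCodim O' 1 ∧ O ⊆ closure O'}

end GrassmannConormal

end

open GrassmannConormal

/-! `M_lam` consists of the matrices supported on a fixed set of positions: row in the index set,
column outside it, strictly above the diagonal. On it `B_lam` acts by adding multiples of rows to
higher rows and of columns to columns further right, and by rescaling. Elimination brings every
orbit to a rook matrix `A` (`exists_isRook_mem_orbit`). The infinitesimal action at `A` reaches
exactly the positions that have a non-zero entry of `A` weakly to the left or weakly below. The
other, uncovered positions span a slice transverse to the orbit, and the inverse function theorem
projects a neighbourhood of `A` to this slice (`exists_sliceProj`). Ranks of lower left blocks are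
constant on orbits; they show that the slice meets the orbit only in `A`, so the codimension is the
number of uncovered positions.

In codimension two the slice is a plane. Torus elements that fix `A` rescale its two coordinates
independently (`exists_separating_set`), so each of the four coordinate strata lies in a single
orbit, and the ranks put the two punctured axes in different orbits (`single_not_mem_orbit`). The
codimension one orbits near `A` are then those of the axes that do not lie in the orbit of the open
stratum. At most one axis can be lost in this way, which leaves one or two. The closure of the orbit
of a remaining axis is locally the zero set of the other slice coordinate, hence smooth, and two
such closures cross normally. `IsPlaneSlice` isolates these properties, and
`codim_one_orbits_of_isPlaneSlice` draws the conclusion for any linear action. -/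

noncomputable section

namespace GrassmannConormal

/-! ### Submersions, tangent cones and codimension. -/

section Calculus

variable {E : Type*} [NormedAddCommGroup E] [NormedSpace ℂ E]
  {F : Type*} [NormedAddCommGroup F] [NormedSpace ℂ F]

/-- The kernel of the differential of a submersion is contained in the tangent cone of its zero
set. -/
theorem ker_subset_tangentConeAt [CompleteSpace E] [FiniteDimensional ℂ F]
    {f : E → F} {f' : E →L[ℂ] F} {p : E} {Z : Set E} (hf : HasStrictFDerivAt f f' p)
    (hs : Function.Surjective f') (hp : f p = 0) (hZ : ∀ᶠ x in 𝓝 p, f x = 0 → x ∈ Z) :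
    {v | f' v = 0} ⊆ tangentConeAt ℂ Z p := by
  obtain ⟨R, hR⟩ := f'.exists_rightInverse_of_surjective (LinearMap.range_eq_top.2 hs)
  have hR' : ∀ y, f' (R y) = y := fun y => by
    simpa using congrArg (fun h : F →L[ℂ] F => h y) hR
  -- This chart straightens `f`: `f' ∘ g = f`, and the derivative of `g` at `p` is the identity. Its
  -- local inverse therefore carries the kernel of `f'` into the zero set of `f`.
  let g : E → E := fun x => x - p + R (f x - f' (x - p))
  have hfg : ∀ x, f' (g x) = f x := fun x => by simp [g, hR']
  have hgp : g p = 0 := by simp [g, hp]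
  have hg : HasStrictFDerivAt g ((ContinuousLinearEquiv.refl ℂ E : E ≃L[ℂ] E) : E →L[ℂ] E) p := by
    have h1 : HasStrictFDerivAt (fun x => x - p) (ContinuousLinearMap.id ℂ E) p :=
      (hasStrictFDerivAt_id p).sub_const p
    have h2 := h1.add (R.hasStrictFDerivAt.comp p (hf.sub (f'.hasStrictFDerivAt.comp p h1)))
    have hid : ((ContinuousLinearEquiv.refl ℂ E : E ≃L[ℂ] E) : E →L[ℂ] E) =
        ContinuousLinearMap.id ℂ E + R ∘SL (f' - f' ∘SL ContinuousLinearMap.id ℂ E) := by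
      ext v
      simp
    rw [hid]
    exact h2
  have hψ := hg.to_localInverse
  have hinv := hg.eventually_right_inverse
  have htend := hg.localInverse_tendsto
  have hψp := hg.localInverse_apply_image
  set ψ := hg.localInverse g _ p
  rw [hgp] at hψ hinv htend hψp
  have hgood : ∀ᶠ y in 𝓝 (0 : E), f' y = 0 → ψ y ∈ Z := by
    filter_upwards [hinv, htend.eventually hZ] with y h1 h2 h3
    apply h2
    rw [← hfg, h1, h3]
  intro v hv
  have hv1 : v ∈ tangentConeAt ℂ ({y | f' y = 0} ∩ {y | f' y = 0 → ψ y ∈ Z}) 0 := by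
    rw [tangentConeAt_inter_nhds hgood]
    refine mem_tangentConeAt_of_add_smul_mem (l := 𝓝[≠] (0 : ℂ)) (c := id) Filter.tendsto_id ?_
    refine Filter.Eventually.of_forall fun c => ?_
    have : f' v = 0 := hv
    simp [this]
  have h2 := (hψ.hasFDerivAt.hasFDerivWithinAt
    (s := {y | f' y = 0} ∩ {y | f' y = 0 → ψ y ∈ Z})).mapsTo_tangent_cone hv1
  rw [hψp] at h2
  refine tangentConeAt_mono ?_ (by simpa using h2)
  rintro _ ⟨y, ⟨hy1, hy2⟩, rfl⟩
  exact hy2 hy1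

/-- The tangent cone of a set on which a function vanishes is contained in the kernel of the
differential. -/
theorem tangentConeAt_subset_ker {f : E → F} {f' : E →L[ℂ] F} {p : E} {Z : Set E}
    (hf : HasFDerivAt f f' p) (hp : f p = 0) (hZ : ∀ᶠ x in 𝓝 p, x ∈ Z → f x = 0) :
    tangentConeAt ℂ Z p ⊆ {v | f' v = 0} := by
  intro v hv
  -- Along `Z` the map is constant, so zero is also a derivative within `Z`; derivatives within a
  -- set agree on its tangent cone.
  have h0 : HasFDerivWithinAt f (0 : E →L[ℂ] F) Z p := by
    refine (hasFDerivWithinAt_const (0 : F) p Z).congr_of_eventuallyEq ?_ hp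
    exact eventually_nhdsWithin_iff.2 hZ
  simpa using hf.hasFDerivWithinAt.unique_on h0 hv

/-- The tangent cone is already a linear subspace here, so taking its span adds nothing. -/
theorem tangentSpaceAt_eq_ker [CompleteSpace E] [FiniteDimensional ℂ F]
    {f : E → F} {p : E} {Z : Set E} (hf : AnalyticAt ℂ f p)
    (hs : Function.Surjective (fderiv ℂ f p)) (hp : p ∈ Z)
    (hZ : ∀ᶠ x in 𝓝 p, x ∈ Z ↔ f x = 0) :
    tangentSpaceAt Z p = LinearMap.ker (fderiv ℂ f p : E →ₗ[ℂ] F) := by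
  have hp0 : f p = 0 := hZ.self_of_nhds.1 hp
  have : tangentConeAt ℂ Z p = (LinearMap.ker (fderiv ℂ f p : E →ₗ[ℂ] F) : Set E) :=
    Set.Subset.antisymm
      (tangentConeAt_subset_ker hf.hasStrictFDerivAt.hasFDerivAt hp0 (hZ.mono fun _ h => h.1))
      (ker_subset_tangentConeAt hf.hasStrictFDerivAt hs hp0 (hZ.mono fun _ h => h.2))
  rw [tangentSpaceAt, this, Submodule.span_eq]

/-- The codimension of a submanifold is determined by the underlying set. -/
theorem IsSmoothAt.codim_unique [FiniteDimensional ℂ E] {Z : Set E} {c d : ℕ} {p : E}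
    (hc : IsSmoothAt Z c p) (hd : IsSmoothAt Z d p) : c = d := by
  have := FiniteDimensional.complete ℂ E
  obtain ⟨hp, f, hf, hfs, hfZ⟩ := hc
  obtain ⟨-, g, hg, hgs, hgZ⟩ := hd
  have h1 := LinearMap.finrank_range_add_finrank_ker (fderiv ℂ f p : E →ₗ[ℂ] (Fin c → ℂ))
  have h2 := LinearMap.finrank_range_add_finrank_ker (fderiv ℂ g p : E →ₗ[ℂ] (Fin d → ℂ))
  rw [← tangentSpaceAt_eq_ker hf hfs hp hfZ, LinearMap.range_eq_top.2 hfs, finrank_top,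
    Module.finrank_fin_fun] at h1
  rw [← tangentSpaceAt_eq_ker hg hgs hp hgZ, LinearMap.range_eq_top.2 hgs, finrank_top,
    Module.finrank_fin_fun] at h2
  omega

/-- A neighbourhood is cut out by the empty system of equations, so its codimension is zero, and
codimension is unique. -/
theorem not_isSmoothAt_of_mem_nhds [FiniteDimensional ℂ E] {Z : Set E} {c : ℕ} {p : E}
    (hZ : Z ∈ 𝓝 p) (hc : c ≠ 0) : ¬ IsSmoothAt Z c p := by
  intro h
  have h0 : IsSmoothAt Z 0 p := by
    refine ⟨mem_of_mem_nhds hZ, fun _ _ => 0, analyticAt_const, ?_, ?_⟩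
    · exact fun y => ⟨0, Subsingleton.elim _ _⟩
    · filter_upwards [hZ] with x hx
      exact ⟨fun _ => Subsingleton.elim _ _, fun _ => hx⟩
  exact hc (h.codim_unique h0)

theorem isSmoothAt_one_of_fderiv_ne {Z : Set E} {x : E} {φ : E → ℂ}
    (hφ : AnalyticAt ℂ φ x) (hv : ∃ v, fderiv ℂ φ x v ≠ 0) (hx : x ∈ Z)
    (hZ : ∀ᶠ y in 𝓝 x, y ∈ Z ↔ φ y = 0) : IsSmoothAt Z 1 x := by
  refine ⟨hx, fun y _ => φ y, ?_, ?_, ?_⟩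
  · exact analyticAt_pi_iff.2 fun _ => hφ
  · have hd : HasFDerivAt (fun y (_ : Fin 1) => φ y)
        (ContinuousLinearMap.pi fun _ => fderiv ℂ φ x) x :=
      hasFDerivAt_pi.2 fun _ => hφ.differentiableAt.hasFDerivAt
    rw [hd.fderiv]
    obtain ⟨v, hv⟩ := hv
    intro y
    refine ⟨(y 0 / fderiv ℂ φ x v) • v, ?_⟩
    ext k
    rw [Subsingleton.elim k 0]
    simp [hv]
  · filter_upwards [hZ] with y hy
    rw [hy, funext_iff]
    simp

theorem transverseAt_of_normalCrossingsAt [CompleteSpace E] {Z₁ Z₂ : Set E} {p : E}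
    (h : NormalCrossingsAt Z₁ Z₂ p) : TransverseAt Z₁ Z₂ p := by
  obtain ⟨h1, h2, f, hf, hs, hZ⟩ := h
  have hcomp : ∀ i, HasStrictFDerivAt (fun x => f x i)
      ((ContinuousLinearMap.proj i : (Fin 2 → ℂ) →L[ℂ] ℂ).comp (fderiv ℂ f p)) p := fun i =>
    (ContinuousLinearMap.proj i : (Fin 2 → ℂ) →L[ℂ] ℂ).hasStrictFDerivAt.comp p
      hf.hasStrictFDerivAt
  have hsurj : ∀ i, Function.Surjective
      ((ContinuousLinearMap.proj i : (Fin 2 → ℂ) →L[ℂ] ℂ).comp (fderiv ℂ f p)) := fun i y => by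
    obtain ⟨v, hv⟩ := hs fun _ => y
    exact ⟨v, by simp [hv]⟩
  have hZp := hZ.self_of_nhds
  have k1 := ker_subset_tangentConeAt (hcomp 0) (hsurj 0) (hZp.1.1 h1)
    (hZ.mono fun _ h => h.1.2)
  have k2 := ker_subset_tangentConeAt (hcomp 1) (hsurj 1) (hZp.2.1 h2)
    (hZ.mono fun _ h => h.2.2)
  rw [TransverseAt, eq_top_iff]
  intro v _
  -- In the decomposition `v = w + (v - w)`, the first differential kills `w` and the second kills
  -- `v - w`.
  obtain ⟨w, hw⟩ := hs ![0, fderiv ℂ f p v 1]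
  have hvw : v = w + (v - w) := by abel
  rw [hvw]
  refine Submodule.add_mem_sup (Submodule.subset_span (k1 ?_)) (Submodule.subset_span (k2 ?_))
  · simp [hw]
  · simp [hw]

end Calculus

/-! ### Orbits of a linear action near a point with a plane slice. -/

section LinearAction

theorem smul_mem_orbit_iff {G X : Type*} [Group G] [MulAction G X] (g : G) (x y : X) :
    g • x ∈ MulAction.orbit G y ↔ x ∈ MulAction.orbit G y := by
  rw [← MulAction.orbit_eq_iff, MulAction.orbit_smul, MulAction.orbit_eq_iff]

variable {E : Type*} [NormedAddCommGroup E] [NormedSpace ℂ E]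
  {G : Type*} [Group G] [MulAction G E]

/-- The group `G` acts on `E` by continuous linear automorphisms. -/
def ActsLinearly (G : Type*) [Group G] (E : Type*) [NormedAddCommGroup E] [NormedSpace ℂ E]
    [MulAction G E] : Prop :=
  ∀ g : G, ∃ e : E ≃L[ℂ] E, ∀ x, e x = g • x

/-- Pulling back a submersion at `p` by a group element yields a submersion at the translate of
`p`. -/
theorem ActsLinearly.exists_translate (hG : ActsLinearly G E) {F : Type*} [NormedAddCommGroup F]
    [NormedSpace ℂ F] {f : E → F} {p : E} (hf : AnalyticAt ℂ f p)
    (hs : Function.Surjective (fderiv ℂ f p)) (g : G) {P : E → F → Prop}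
    (hP : ∀ᶠ x in 𝓝 p, P (g • x) (f x)) :
    ∃ f₁ : E → F, AnalyticAt ℂ f₁ (g • p) ∧ Function.Surjective (fderiv ℂ f₁ (g • p)) ∧
      f₁ (g • p) = f p ∧ ∀ᶠ x in 𝓝 (g • p), P x (f₁ x) := by
  obtain ⟨e, he⟩ := hG g
  have hsymm : e.symm (g • p) = p := by rw [← he, e.symm_apply_apply]
  have hf' : AnalyticAt ℂ f (e.symm (g • p)) := by rwa [hsymm]
  refine ⟨fun x => f (e.symm x), ?_, ?_, by simp only [hsymm], ?_⟩
  · exact hf'.comp ((e.symm : E →L[ℂ] E).analyticAt (g • p))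
  · have h := hf'.differentiableAt.hasFDerivAt.comp (g • p)
      (e.symm : E →L[ℂ] E).hasFDerivAt
    have h' : fderiv ℂ (fun x => f (e.symm x)) (g • p) = _ := h.fderiv
    rw [h', hsymm]
    intro y
    obtain ⟨v, hv⟩ := hs y
    exact ⟨e v, by simp [hv]⟩
  · have ht : Filter.Tendsto e.symm (𝓝 (g • p)) (𝓝 p) := by
      have := e.symm.continuous.tendsto (g • p)
      rwa [hsymm] at this
    filter_upwards [ht.eventually hP] with x hx
    rwa [← he, e.apply_symm_apply] at hx

theorem ActsLinearly.isSmoothAt_smul (hG : ActsLinearly G E) {Z : Set E} {c : ℕ} {p : E}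
    (h : IsSmoothAt Z c p) (hZ : ∀ (g : G) (x : E), g • x ∈ Z ↔ x ∈ Z) (g : G) :
    IsSmoothAt Z c (g • p) := by
  obtain ⟨hp, f, hf, hs, hfZ⟩ := h
  obtain ⟨f₁, hf₁, hs₁, -, hfZ₁⟩ := hG.exists_translate hf hs g
    (P := fun x y => x ∈ Z ↔ y = 0) (hfZ.mono fun x hx => by rwa [hZ])
  exact ⟨(hZ g p).2 hp, f₁, hf₁, hs₁, hfZ₁⟩

theorem ActsLinearly.smul_mem_closure_iff (hG : ActsLinearly G E) {Z : Set E}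
    (hZ : ∀ (g : G) (x : E), x ∈ Z → g • x ∈ Z) (g : G) (x : E) :
    g • x ∈ closure Z ↔ x ∈ closure Z := by
  have key : ∀ (g : G) (x : E), x ∈ closure Z → g • x ∈ closure Z := by
    intro g x hx
    obtain ⟨e, he⟩ := hG g
    rw [← he]
    exact map_mem_closure e.continuous hx fun y hy => by rw [he]; exact hZ g y hy
  exact ⟨fun h => by simpa using key g⁻¹ _ h, key g x⟩

/-- A two-dimensional slice to the orbit of `p`, on which the orbits are unions of the four
coordinate strata of `ℂ²`, and such that the two coordinate axes lie in different orbits. The map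
`f` is the projection of a neighbourhood of `p` to the slice, parametrized by `q`. -/
structure IsPlaneSlice (G : Type*) [Group G] {E : Type*} [NormedAddCommGroup E]
    [NormedSpace ℂ E] [MulAction G E] (p : E) (f : E → (Fin 2 → ℂ)) (q : (Fin 2 → ℂ) → E) :
    Prop where
  analyticAt : AnalyticAt ℂ f p
  surjective : Function.Surjective (fderiv ℂ f p)
  map_self : f p = 0
  mem_orbit : ∀ᶠ x in 𝓝 p, x ∈ MulAction.orbit G (q (f x))
  strata : ∀ c d : Fin 2 → ℂ, (∀ i, c i = 0 ↔ d i = 0) → q c ∈ MulAction.orbit G (q d)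
  eq_zero : ∀ c, q c ∈ MulAction.orbit G (q 0) → c = 0
  axes : q (Pi.single 0 1) ∉ MulAction.orbit G (q (Pi.single 1 1))

namespace IsPlaneSlice

variable {p : E} {f : E → (Fin 2 → ℂ)} {q : (Fin 2 → ℂ) → E}

/-- The parametrization `q` can stay the same because only the orbits of its values matter. This
carries local statements at `p` to every point of the orbit. -/
theorem smul (hG : ActsLinearly G E) (h : IsPlaneSlice G p f q) (g : G) :
    ∃ f₁, IsPlaneSlice G (g • p) f₁ q := by
  obtain ⟨f₁, h1, h2, h3, h4⟩ := hG.exists_translate h.analyticAt h.surjective g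
    (P := fun x y => x ∈ MulAction.orbit G (q y))
    (h.mem_orbit.mono fun x hx => by rwa [smul_mem_orbit_iff])
  exact ⟨f₁, h1, h2, h3.trans h.map_self, h4, h.strata, h.eq_zero, h.axes⟩

theorem axes_ne (h : IsPlaneSlice G p f q) {i j : Fin 2} (hij : i ≠ j) :
    q (Pi.single i 1) ∉ MulAction.orbit G (q (Pi.single j 1)) := by
  have h1 := h.axes
  have h2 := mt MulAction.mem_orbit_symm.1 h.axes
  fin_cases i <;> fin_cases j <;> simp_all

/-- The axioms of a slice allow the open stratum and an axis to share an orbit; `hD` excludes this.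
The orbit of axis `i` then contains no other stratum, so membership can be read off from which
coordinates of `f` vanish. -/
theorem eventually_mem_axis_iff (h : IsPlaneSlice G p f q) {i j : Fin 2} (hij : i ≠ j)
    (hD : q 1 ∉ MulAction.orbit G (q (Pi.single i 1))) :
    ∀ᶠ x in 𝓝 p, x ∈ MulAction.orbit G (q (Pi.single i 1)) ↔ f x i ≠ 0 ∧ f x j = 0 := by
  filter_upwards [h.mem_orbit] with x hx
  have hcover : ∀ k : Fin 2, k = i ∨ k = j := by
    intro k
    omega
  have hiff : x ∈ MulAction.orbit G (q (Pi.single i 1)) ↔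
      q (f x) ∈ MulAction.orbit G (q (Pi.single i 1)) := by
    rw [← MulAction.orbit_eq_iff, ← MulAction.orbit_eq_iff, MulAction.orbit_eq_iff.2 hx]
  rw [hiff]
  by_cases hi : f x i = 0 <;> by_cases hj : f x j = 0
  · refine iff_of_false (fun hmem => ?_) (by simp [hi])
    have hz : f x = 0 := by
      ext k
      rcases hcover k with rfl | rfl <;> assumption
    rw [hz] at hmem
    have := congrFun (h.eq_zero _ (MulAction.mem_orbit_symm.1 hmem)) i
    simp at this
  · refine iff_of_false (fun hmem => ?_) (by simp [hi])
    have hs := h.strata (f x) (Pi.single j 1) fun k => by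
      rcases hcover k with rfl | rfl
      · simp [hi, hij]
      · simp [hj]
    apply h.axes_ne hij.symm
    rw [← MulAction.orbit_eq_iff] at hs hmem ⊢
    rw [← hs, hmem]
  · refine iff_of_true ?_ ⟨hi, hj⟩
    refine h.strata _ _ fun k => ?_
    rcases hcover k with rfl | rfl
    · simp [hi]
    · simp [hj, hij.symm]
  · refine iff_of_false (fun hmem => ?_) (by simp [hj])
    have hs := h.strata (f x) 1 fun k => by
      rcases hcover k with rfl | rfl
      · simp [hi]
      · simp [hj]
    apply hD
    rw [← MulAction.orbit_eq_iff] at hs hmem ⊢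
    rw [← hs, hmem]

theorem orbit_eq (h : IsPlaneSlice G p f q) :
    MulAction.orbit G p = MulAction.orbit G (q 0) := by
  rw [MulAction.orbit_eq_iff, ← h.map_self]
  exact h.mem_orbit.self_of_nhds

/-- A submersion is open at `p`, so points of the axis arbitrarily close to `0` have preimages
arbitrarily close to `p`. -/
theorem mem_closure_axis [CompleteSpace E] (h : IsPlaneSlice G p f q) {i j : Fin 2} (hij : i ≠ j)
    (hD : q 1 ∉ MulAction.orbit G (q (Pi.single i 1))) :
    p ∈ closure (MulAction.orbit G (q (Pi.single i 1))) := by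
  have hmap := h.analyticAt.hasStrictFDerivAt.map_nhds_eq_of_surj
    (LinearMap.range_eq_top.2 h.surjective)
  rw [h.map_self] at hmap
  rw [mem_closure_iff_frequently]
  have hfreq : ∃ᶠ y in 𝓝 (0 : Fin 2 → ℂ), y i ≠ 0 ∧ y j = 0 := by
    have ht : Filter.Tendsto (fun t : ℂ => (Pi.single i t : Fin 2 → ℂ)) (𝓝[≠] 0) (𝓝 0) := by
      have : Continuous fun t : ℂ => (Pi.single i t : Fin 2 → ℂ) :=
        continuous_single (A := fun _ : Fin 2 => ℂ) i
      have := this.tendsto 0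
      rw [Pi.single_zero] at this
      exact this.mono_left nhdsWithin_le_nhds
    refine ht.frequently (Filter.Eventually.frequently ?_)
    filter_upwards [self_mem_nhdsWithin] with t ht
    simpa [hij.symm] using ht
  rw [← hmap, Filter.frequently_map] at hfreq
  refine (hfreq.and_eventually (h.eventually_mem_axis_iff hij hD)).mono ?_
  rintro x ⟨h1, h2⟩
  exact h2.2 h1

theorem eventually_mem_closure_axis_iff [CompleteSpace E] (hG : ActsLinearly G E)
    (h : IsPlaneSlice G p f q) {i j : Fin 2} (hij : i ≠ j)
    (hD : q 1 ∉ MulAction.orbit G (q (Pi.single i 1))) :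
    ∀ᶠ x in 𝓝 p, x ∈ closure (MulAction.orbit G (q (Pi.single i 1))) ↔ f x j = 0 := by
  filter_upwards [h.eventually_mem_axis_iff hij hD,
    (h.eventually_mem_axis_iff hij hD).eventually_nhds, h.mem_orbit,
    h.analyticAt.eventually_analyticAt] with x hx hx' hmem han
  constructor
  · intro hc
    by_contra hne
    have hcont : ContinuousAt (fun y => f y j) x :=
      (continuous_apply j).continuousAt.comp han.continuousAt
    rw [mem_closure_iff_frequently] at hc
    -- If `f x j ≠ 0`, this persists near `x`, where orbit points must have `j`-th coordinate zero.
    obtain ⟨y, hy1, hy2, hy3⟩ := (hc.and_eventually (hx'.and (hcont.eventually_ne hne))).exists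
    exact hy3 (hy2.1 hy1).2
  · intro hj
    -- Where both coordinates vanish, `x` lies in the orbit of `p`, and the closure is invariant and
    -- contains `p`.
    by_cases hi : f x i = 0
    · have hz : f x = 0 := by
        ext k
        have : k = i ∨ k = j := by omega
        rcases this with rfl | rfl <;> assumption
      rw [hz, ← h.orbit_eq] at hmem
      obtain ⟨g, rfl⟩ := hmem
      exact (hG.smul_mem_closure_iff (fun g x hx => (smul_mem_orbit_iff g x _).2 hx) g p).2
        (h.mem_closure_axis hij hD)
    · exact subset_closure (hx.2 ⟨hi, hj⟩)

theorem surjective_component (h : IsPlaneSlice G p f q) (j : Fin 2) :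
    ∃ v, fderiv ℂ (fun x => f x j) p v ≠ 0 := by
  obtain ⟨v, hv⟩ := h.surjective 1
  refine ⟨v, ?_⟩
  have := ((ContinuousLinearMap.proj j : (Fin 2 → ℂ) →L[ℂ] ℂ).hasFDerivAt.comp p
    h.analyticAt.differentiableAt.hasFDerivAt).fderiv
  have h' : fderiv ℂ (fun x => f x j) p = _ := this
  rw [h']
  simp [hv]

theorem isSmoothAt_closure_axis [CompleteSpace E] (hG : ActsLinearly G E)
    (h : IsPlaneSlice G p f q) {i j : Fin 2} (hij : i ≠ j)
    (hD : q 1 ∉ MulAction.orbit G (q (Pi.single i 1))) :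
    IsSmoothAt (closure (MulAction.orbit G (q (Pi.single i 1)))) 1 p :=
  isSmoothAt_one_of_fderiv_ne (analyticAt_pi_iff.1 h.analyticAt j) (h.surjective_component j)
    (h.mem_closure_axis hij hD) (h.eventually_mem_closure_axis_iff hG hij hD)

/-- Smoothness is checked at one orbit point so near to `p` that the differential of the `j`-th
coordinate is still non-zero; homogeneity spreads it over the orbit. -/
theorem hasCodim_axis [CompleteSpace E] (hG : ActsLinearly G E)
    (h : IsPlaneSlice G p f q) {i j : Fin 2} (hij : i ≠ j)
    (hD : q 1 ∉ MulAction.orbit G (q (Pi.single i 1))) :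
    HasCodim (MulAction.orbit G (q (Pi.single i 1))) 1 := by
  have hfj := analyticAt_pi_iff.1 h.analyticAt j
  obtain ⟨v, hv⟩ := h.surjective_component j
  have hne : ∀ᶠ x in 𝓝 p, fderiv ℂ (fun x => f x j) x v ≠ 0 :=
    (hfj.fderiv.continuousAt.clm_apply continuousAt_const).eventually_ne hv
  obtain ⟨x, hx, hiff, hiff', han, hne'⟩ := ((mem_closure_iff_frequently.1
    (h.mem_closure_axis hij hD)).and_eventually
      ((h.eventually_mem_axis_iff hij hD).and
        ((h.eventually_mem_axis_iff hij hD).eventually_nhds.and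
          (h.analyticAt.eventually_analyticAt.and hne)))).exists
  have hsm : IsSmoothAt (MulAction.orbit G (q (Pi.single i 1))) 1 x := by
    refine isSmoothAt_one_of_fderiv_ne (analyticAt_pi_iff.1 han j) ⟨v, hne'⟩ hx ?_
    have hcont : ContinuousAt (fun y => f y i) x :=
      (continuous_apply i).continuousAt.comp han.continuousAt
    filter_upwards [hiff', hcont.eventually_ne (hiff.1 hx).1] with y hy hy'
    rw [hy]
    exact and_iff_right hy'
  intro y hy
  obtain ⟨g, rfl⟩ : y ∈ MulAction.orbit G x := by
    rwa [MulAction.orbit_eq_iff.2 hx]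
  exact hG.isSmoothAt_smul hsm (fun g x => smul_mem_orbit_iff g x _) g

theorem orbit_subset_closure_axis [CompleteSpace E] (hG : ActsLinearly G E)
    (h : IsPlaneSlice G p f q) {i j : Fin 2} (hij : i ≠ j)
    (hD : q 1 ∉ MulAction.orbit G (q (Pi.single i 1))) :
    MulAction.orbit G p ⊆ closure (MulAction.orbit G (q (Pi.single i 1))) := by
  rintro _ ⟨g, rfl⟩
  exact (hG.smul_mem_closure_iff (fun g x hx => (smul_mem_orbit_iff g x _).2 hx) g p).2
    (h.mem_closure_axis hij hD)

/-- A codimension one orbit whose closure contains `p` passes through one of the axes, and does not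
meet the open stratum of the slice. -/
theorem eq_axis_of_hasCodim_one [FiniteDimensional ℂ E] (h : IsPlaneSlice G p f q)
    (hp : HasCodim (MulAction.orbit G p) 2) {a : E} (ha : HasCodim (MulAction.orbit G a) 1)
    (hpa : p ∈ closure (MulAction.orbit G a)) :
    ∃ i, MulAction.orbit G a = MulAction.orbit G (q (Pi.single i 1)) ∧
      q 1 ∉ MulAction.orbit G (q (Pi.single i 1)) := by
  -- Otherwise the orbit of `a` would contain all points near `p` with both coordinates non-zero. It
  -- would then have interior points, against codimension one.
  have hopen : q 1 ∉ MulAction.orbit G a := by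
    intro hmem
    have hmap := h.analyticAt.hasStrictFDerivAt.map_nhds_eq_of_surj
      (LinearMap.range_eq_top.2 h.surjective)
    rw [h.map_self] at hmap
    have hfreq : ∃ᶠ y in 𝓝 (0 : Fin 2 → ℂ), ∀ k, y k ≠ 0 := by
      have ht : Filter.Tendsto (fun t : ℂ => (fun _ => t : Fin 2 → ℂ)) (𝓝[≠] 0) (𝓝 0) := by
        have : Continuous fun t : ℂ => (fun _ => t : Fin 2 → ℂ) :=
          continuous_pi fun _ => continuous_id
        exact (this.tendsto 0).mono_left nhdsWithin_le_nhds
      refine ht.frequently (Filter.Eventually.frequently ?_)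
      filter_upwards [self_mem_nhdsWithin] with t ht k
      exact ht
    rw [← hmap, Filter.frequently_map] at hfreq
    obtain ⟨x, hx, hx', han⟩ := (hfreq.and_eventually
      (h.mem_orbit.eventually_nhds.and h.analyticAt.eventually_analyticAt)).exists
    have hnhds : MulAction.orbit G a ∈ 𝓝 x := by
      have hcont : ∀ᶠ y in 𝓝 x, ∀ k, f y k ≠ 0 := Filter.eventually_all.2 fun k =>
        ContinuousAt.eventually_ne
          ((continuous_apply k).continuousAt.comp han.continuousAt) (hx k)
      filter_upwards [hx', hcont] with y hy hy'
      have hs := h.strata (f y) 1 fun k => by simp [hy' k]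
      rw [← MulAction.orbit_eq_iff] at hs hmem hy ⊢
      rw [hy, hs, hmem]
    exact not_isSmoothAt_of_mem_nhds hnhds one_ne_zero (ha x (mem_of_mem_nhds hnhds))
  obtain ⟨x, hx, hx'⟩ :=
    ((mem_closure_iff_frequently.1 hpa).and_eventually h.mem_orbit).exists
  have hax : MulAction.orbit G a = MulAction.orbit G (q (f x)) := by
    rw [← MulAction.orbit_eq_iff] at hx hx'
    rw [← hx, hx']
  have hstr : ∀ d : Fin 2 → ℂ, (∀ k, f x k = 0 ↔ d k = 0) →
      MulAction.orbit G a = MulAction.orbit G (q d) := fun d hd =>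
    hax.trans (MulAction.orbit_eq_iff.2 (h.strata _ _ hd))
  by_cases h0 : f x 0 = 0 <;> by_cases h1 : f x 1 = 0
  · exfalso
    have heq := hstr 0 (by simp [Fin.forall_fin_two, h0, h1])
    rw [← h.orbit_eq] at heq
    rw [heq] at ha
    have hpp := MulAction.mem_orbit_self (M := G) p
    have := (ha p hpp).codim_unique (hp p hpp)
    omega
  · have heq := hstr (Pi.single 1 1) (by simp [Fin.forall_fin_two, h0, h1])
    exact ⟨1, heq, heq ▸ hopen⟩
  · have heq := hstr (Pi.single 0 1) (by simp [Fin.forall_fin_two, h0, h1])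
    exact ⟨0, heq, heq ▸ hopen⟩
  · exfalso
    have heq := hstr 1 (by simp [Fin.forall_fin_two, h0, h1])
    exact hopen (heq ▸ MulAction.mem_orbit_self _)

theorem normalCrossingsAt [CompleteSpace E] (hG : ActsLinearly G E) (h : IsPlaneSlice G p f q)
    {i j : Fin 2} (hij : i ≠ j) (hi : q 1 ∉ MulAction.orbit G (q (Pi.single i 1)))
    (hj : q 1 ∉ MulAction.orbit G (q (Pi.single j 1))) :
    NormalCrossingsAt (closure (MulAction.orbit G (q (Pi.single i 1))))
      (closure (MulAction.orbit G (q (Pi.single j 1)))) p := by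
  -- The closure belonging to axis `i` is the zero set of coordinate `j`, so the two coordinates are
  -- listed in the order `j, i`.
  have hbij : Function.Injective ![j, i] := by
    intro a b hab
    fin_cases a <;> fin_cases b <;> simp_all [eq_comm]
  let e : Fin 2 ≃ Fin 2 := Equiv.ofBijective _ (Finite.injective_iff_bijective.1 hbij)
  let L : (Fin 2 → ℂ) ≃L[ℂ] (Fin 2 → ℂ) :=
    (LinearEquiv.funCongrLeft ℂ ℂ e).toContinuousLinearEquiv
  have hL : ∀ y k, L y k = y (![j, i] k) := fun y k => rfl
  refine ⟨h.mem_closure_axis hij hi, h.mem_closure_axis hij.symm hj, fun x => L (f x), ?_, ?_, ?_⟩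
  · exact ((L : (Fin 2 → ℂ) →L[ℂ] (Fin 2 → ℂ)).analyticAt _).comp h.analyticAt
  · have := ((L : (Fin 2 → ℂ) →L[ℂ] (Fin 2 → ℂ)).hasFDerivAt.comp p
      h.analyticAt.differentiableAt.hasFDerivAt).fderiv
    have h' : fderiv ℂ (fun x => L (f x)) p = _ := this
    rw [h']
    exact L.surjective.comp h.surjective
  · filter_upwards [h.eventually_mem_closure_axis_iff hG hij hi,
      h.eventually_mem_closure_axis_iff hG hij.symm hj] with x h1 h2
    simp [hL, h1, h2]

end IsPlaneSlice

/-- The conclusion for an orbit of codimension two that has a slice as in `IsPlaneSlice`. -/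
theorem codim_one_orbits_of_isPlaneSlice [FiniteDimensional ℂ E] (hG : ActsLinearly G E)
    {p : E} {f : E → (Fin 2 → ℂ)} {q : (Fin 2 → ℂ) → E} (h : IsPlaneSlice G p f q)
    (hp : HasCodim (MulAction.orbit G p) 2) (C : Set (Set E))
    (hC : ∀ O', O' ∈ C ↔ (∃ a, O' = MulAction.orbit G a) ∧ HasCodim O' 1 ∧
      MulAction.orbit G p ⊆ closure O') :
    (C.ncard = 1 ∨ C.ncard = 2) ∧
    (∀ O' ∈ C, ∀ x ∈ MulAction.orbit G p, IsSmoothAt (closure O') 1 x) ∧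
    (∀ O₁ ∈ C, ∀ O₂ ∈ C, O₁ ≠ O₂ → ∀ x ∈ MulAction.orbit G p,
      TransverseAt (closure O₁) (closure O₂) x ∧
      NormalCrossingsAt (closure O₁) (closure O₂) x) := by
  have := FiniteDimensional.complete ℂ E
  have hother : ∀ i : Fin 2, ∃ j, i ≠ j := fun i => (exists_ne i).imp fun _ h => h.symm
  have hmem : ∀ O', O' ∈ C ↔ ∃ i, O' = MulAction.orbit G (q (Pi.single i 1)) ∧
      q 1 ∉ MulAction.orbit G (q (Pi.single i 1)) := by
    intro O'
    rw [hC]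
    constructor
    · rintro ⟨⟨a, rfl⟩, ha, hpa⟩
      exact h.eq_axis_of_hasCodim_one hp ha (hpa (MulAction.mem_orbit_self p))
    · rintro ⟨i, rfl, hi⟩
      obtain ⟨j, hij⟩ := hother i
      exact ⟨⟨_, rfl⟩, h.hasCodim_axis hG hij hi, h.orbit_subset_closure_axis hG hij hi⟩
  refine ⟨?_, ?_, ?_⟩
  · have hne : MulAction.orbit G (q (Pi.single 0 1)) ≠ MulAction.orbit G (q (Pi.single 1 1)) :=
      fun heq => h.axes (MulAction.orbit_eq_iff.1 heq)
    -- The open stratum cannot absorb both axes, since they lie in different orbits. This is why at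
    -- least one codimension one orbit exists.
    by_cases h0 : q 1 ∈ MulAction.orbit G (q (Pi.single 0 1)) <;>
      by_cases h1 : q 1 ∈ MulAction.orbit G (q (Pi.single 1 1))
    · exact absurd ((MulAction.orbit_eq_iff.2 h0).symm.trans (MulAction.orbit_eq_iff.2 h1)) hne
    · left
      have : C = {MulAction.orbit G (q (Pi.single 1 1))} := by
        ext O'
        simp [hmem, Fin.exists_fin_two, h0, h1]
      rw [this, Set.ncard_singleton]
    · left
      have : C = {MulAction.orbit G (q (Pi.single 0 1))} := by
        ext O'
        simp [hmem, Fin.exists_fin_two, h0, h1]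
      rw [this, Set.ncard_singleton]
    · right
      have : C = {MulAction.orbit G (q (Pi.single 0 1)),
          MulAction.orbit G (q (Pi.single 1 1))} := by
        ext O'
        simp [hmem, Fin.exists_fin_two, h0, h1]
      rw [this, Set.ncard_pair hne]
  · rintro O' hO' _ ⟨g, rfl⟩
    obtain ⟨i, rfl, hi⟩ := (hmem _).1 hO'
    obtain ⟨j, hij⟩ := hother i
    obtain ⟨f₁, h₁⟩ := h.smul hG g
    exact h₁.isSmoothAt_closure_axis hG hij hi
  · rintro O₁ hO₁ O₂ hO₂ hne _ ⟨g, rfl⟩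
    obtain ⟨i, rfl, hi⟩ := (hmem _).1 hO₁
    obtain ⟨j, rfl, hj⟩ := (hmem _).1 hO₂
    have hij : i ≠ j := by
      rintro rfl
      exact hne rfl
    obtain ⟨f₁, h₁⟩ := h.smul hG g
    have hnc := h₁.normalCrossingsAt hG hij hi hj
    exact ⟨transverseAt_of_normalCrossingsAt hnc, hnc⟩

end LinearAction

/-! ### Matrix coordinates on the conormal fibre; row and column operations. -/

variable {k l : ℕ} {lam : YoungDiagram}

/-- The positions of the matrix entries that may be non-zero on `M_lam`. -/
def InShape (k l : ℕ) (lam : YoungDiagram) (i j : Fin (k + l)) : Prop :=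
  i ∈ indexSet k l lam ∧ j ∉ indexSet k l lam ∧ i < j

theorem mem_fixedPoint_iff {w : Fin (k + l) → ℂ} :
    w ∈ fixedPoint k l lam ↔ ∀ m ∉ indexSet k l lam, w m = 0 := by
  have h : (fun m => Pi.single m (1 : ℂ)) = ⇑(Pi.basisFun ℂ (Fin (k + l))) := by
    ext1 m
    simp
  rw [fixedPoint, h, Module.Basis.mem_span_image]
  constructor
  · intro hw m hm
    by_contra hne
    exact hm (hw (by simpa using hne))
  · intro hw m hm
    by_contra hne
    simp [hw m hne] at hm

theorem mem_conormalFiber_iff {A : Fin (k + l) → Fin (k + l) → ℂ} :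
    A ∈ conormalFiber k l lam ↔ ∀ i j, A i j ≠ 0 → InShape k l lam i j := by
  change (_ ∧ _ ∧ _) ↔ _
  have hof : (Matrix.ofLinearEquiv ℂ).toLinearMap A = Matrix.of A := rfl
  rw [hof]
  constructor
  · rintro ⟨h1, h2, h3⟩ i j hij
    have hi : i ∈ indexSet k l lam := by
      by_contra hi
      have := mem_fixedPoint_iff.1 (h2 (Pi.single j 1)) i hi
      simp at this
      exact hij this
    have hj : j ∉ indexSet k l lam := by
      intro hj
      have := congrFun (h1 (Pi.single j 1) (Submodule.subset_span ⟨j, hj, rfl⟩)) i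
      simp at this
      exact hij this
    refine ⟨hi, hj, ?_⟩
    by_contra hlt
    have hne : j ≠ i := fun h => hj (h ▸ hi)
    have hlt' : j < i := lt_of_le_of_ne (not_lt.1 hlt) hne
    -- For `j < i` this elementary matrix is strictly upper triangular, hence of trace zero, and its
    -- trace pairing with `A` extracts the entry `A i j`.
    have := h3 (Matrix.single j i 1) ⟨?_, ?_⟩
    · rw [Matrix.trace_mul_single] at this
      simp at this
      exact hij this
    · intro a b hab
      refine Matrix.single_apply_of_ne _ _ _ _ _ ?_
      rintro ⟨rfl, rfl⟩
      exact absurd hab (not_lt.2 hlt'.le)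
    · exact Matrix.trace_single_eq_of_ne _ _ _ hne
  · intro h
    refine ⟨fun w hw => ?_, fun v => ?_, fun b hb => ?_⟩
    · ext i
      rw [Matrix.mulVec, dotProduct]
      refine Finset.sum_eq_zero fun j _ => ?_
      by_cases hij : A i j = 0
      · simp [hij]
      · simp [mem_fixedPoint_iff.1 hw j (h i j hij).2.1]
    · refine mem_fixedPoint_iff.2 fun i hi => ?_
      rw [Matrix.mulVec, dotProduct]
      refine Finset.sum_eq_zero fun j _ => ?_
      by_cases hij : A i j = 0
      · simp [hij]
      · exact absurd (h i j hij).1 hi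
    · refine Finset.sum_eq_zero fun i _ => ?_
      rw [Matrix.diag_apply, Matrix.mul_apply]
      refine Finset.sum_eq_zero fun j _ => ?_
      by_cases hij : A i j = 0
      · simp [hij]
      · simp [hb.1 (h i j hij).2.2]

theorem inShape_of_ne (A : conormalFiber k l lam) {i j : Fin (k + l)} (h : A.1 i j ≠ 0) :
    InShape k l lam i j :=
  mem_conormalFiber_iff.1 A.2 i j h

theorem coe_smul_eq (g : borelStab k l lam) (A : conormalFiber k l lam) :
    Matrix.of (g • A).1 = (g.1 : Matrix (Fin (k + l)) (Fin (k + l)) ℂ) * Matrix.of A.1 *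
      ((g.1⁻¹ : Matrix.SpecialLinearGroup (Fin (k + l)) ℂ) :
        Matrix (Fin (k + l)) (Fin (k + l)) ℂ) := rfl

theorem actsLinearly_borelStab : ActsLinearly (borelStab k l lam) (conormalFiber k l lam) := by
  intro g
  have hadd : ∀ (g : borelStab k l lam) (A B : conormalFiber k l lam),
      g • (A + B) = g • A + g • B := by
    intro g A B
    apply Subtype.ext
    apply Matrix.of.injective
    change _ = Matrix.of (g • A).1 + Matrix.of (g • B).1
    rw [coe_smul_eq, coe_smul_eq, coe_smul_eq, ← add_mul, ← mul_add]
    rfl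
  have hsmul : ∀ (g : borelStab k l lam) (c : ℂ) (A : conormalFiber k l lam),
      g • (c • A) = c • (g • A) := by
    intro g c A
    apply Subtype.ext
    apply Matrix.of.injective
    change _ = c • Matrix.of (g • A).1
    rw [coe_smul_eq, coe_smul_eq, ← smul_mul_assoc, ← mul_smul_comm]
    rfl
  let e : conormalFiber k l lam ≃ₗ[ℂ] conormalFiber k l lam :=
    { toFun := fun A => g • A
      invFun := fun A => g⁻¹ • A
      map_add' := hadd g
      map_smul' := hsmul g
      left_inv := fun A => inv_smul_smul g A
      right_inv := fun A => smul_inv_smul g A }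
  exact ⟨e.toContinuousLinearEquiv, fun x => rfl⟩

/-- An invertible upper triangular matrix that preserves `W_lam` moves an element of `M_lam` within
its orbit, also if its determinant is not one. -/
theorem mem_orbit_of_mul_eq {g : Matrix (Fin (k + l)) (Fin (k + l)) ℂ} (hdet : g.det ≠ 0)
    (htri : g.BlockTriangular id)
    (hW : ∀ i ∉ indexSet k l lam, ∀ j ∈ indexSet k l lam, g i j = 0)
    {A A' : conormalFiber k l lam} (h : Matrix.of A'.1 * g = g * Matrix.of A.1) :
    A' ∈ MulAction.orbit (borelStab k l lam) A := by
  -- Scalars act trivially by conjugation, so the determinant can be normalized by a root of its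
  -- inverse. The empty matrix is separate because no root of order zero can be taken.
  obtain ⟨c, hc⟩ : ∃ c : ℂ, c ^ (k + l) * g.det = 1 := by
    rcases Nat.eq_zero_or_pos (k + l) with h0 | hpos
    · have : IsEmpty (Fin (k + l)) := by rw [h0]; infer_instance
      exact ⟨1, by simp [Matrix.det_isEmpty]⟩
    · obtain ⟨c, hc⟩ := IsAlgClosed.exists_pow_nat_eq (g.det)⁻¹ hpos
      exact ⟨c, by rw [hc, inv_mul_cancel₀ hdet]⟩
  let γ : Matrix.SpecialLinearGroup (Fin (k + l)) ℂ :=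
    ⟨c • g, by rw [Matrix.det_smul, Fintype.card_fin, hc]⟩
  have hγ : (γ : Matrix (Fin (k + l)) (Fin (k + l)) ℂ) = c • g := rfl
  have hmem : γ ∈ borelStab k l lam := by
    refine ⟨fun i j hij => ?_, ?_⟩
    · rw [hγ, Matrix.smul_apply, htri hij, smul_zero]
    · have hinj : Function.Injective
          (Matrix.toLin' (γ : Matrix (Fin (k + l)) (Fin (k + l)) ℂ)) := by
        intro v w hvw
        have hinv : ((γ⁻¹ : Matrix.SpecialLinearGroup (Fin (k + l)) ℂ) :
            Matrix (Fin (k + l)) (Fin (k + l)) ℂ) *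
            (γ : Matrix (Fin (k + l)) (Fin (k + l)) ℂ) = 1 := by
          rw [← Matrix.SpecialLinearGroup.coe_mul, inv_mul_cancel,
            Matrix.SpecialLinearGroup.coe_one]
        have := congrArg (Matrix.mulVec ((γ⁻¹ : Matrix.SpecialLinearGroup (Fin (k + l)) ℂ) :
            Matrix (Fin (k + l)) (Fin (k + l)) ℂ)) hvw
        simpa only [Matrix.toLin'_apply, Matrix.mulVec_mulVec, hinv, Matrix.one_mulVec] using this
      -- Only the inclusion of the image in `W` needs checking; injectivity gives equality of
      -- dimensions.
      refine Submodule.eq_of_le_of_finrank_eq ?_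
        (LinearEquiv.finrank_eq (Submodule.equivMapOfInjective _ hinj _)).symm
      rintro _ ⟨w, hw, rfl⟩
      refine mem_fixedPoint_iff.2 fun i hi => ?_
      rw [Matrix.toLin'_apply, Matrix.mulVec, dotProduct]
      refine Finset.sum_eq_zero fun j _ => ?_
      by_cases hj : j ∈ indexSet k l lam
      · simp [hγ, hW i hi j hj]
      · simp [mem_fixedPoint_iff.1 hw j hj]
  refine ⟨⟨γ, hmem⟩, ?_⟩
  apply Subtype.ext
  apply Matrix.of.injective
  change Matrix.of ((⟨γ, hmem⟩ : borelStab k l lam) • A).1 = _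
  have hinv : (γ : Matrix (Fin (k + l)) (Fin (k + l)) ℂ) *
      ((γ⁻¹ : Matrix.SpecialLinearGroup (Fin (k + l)) ℂ) :
        Matrix (Fin (k + l)) (Fin (k + l)) ℂ) = 1 := by
    rw [← Matrix.SpecialLinearGroup.coe_mul, mul_inv_cancel, Matrix.SpecialLinearGroup.coe_one]
  rw [coe_smul_eq]
  have h2 : (γ : Matrix (Fin (k + l)) (Fin (k + l)) ℂ) * Matrix.of A.1 =
      Matrix.of A'.1 * (γ : Matrix (Fin (k + l)) (Fin (k + l)) ℂ) := by
    rw [hγ, smul_mul_assoc, ← h, mul_smul_comm]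
  change (γ : Matrix (Fin (k + l)) (Fin (k + l)) ℂ) * Matrix.of A.1 * _ = _
  rw [h2, mul_assoc, hinv, mul_one]

/-- `X` describes an upper triangular operation on the rows in the index set. -/
def IsRowOp (k l : ℕ) (lam : YoungDiagram) (X : Matrix (Fin (k + l)) (Fin (k + l)) ℂ) : Prop :=
  ∀ i j, X i j ≠ 0 → i ∈ indexSet k l lam ∧ j ∈ indexSet k l lam ∧ i ≤ j

/-- `Y` describes an upper triangular operation on the columns outside the index set. -/
def IsColOp (k l : ℕ) (lam : YoungDiagram) (Y : Matrix (Fin (k + l)) (Fin (k + l)) ℂ) : Prop :=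
  ∀ i j, Y i j ≠ 0 → i ∉ indexSet k l lam ∧ j ∉ indexSet k l lam ∧ i ≤ j

/-- `A * X = 0`, because `A` lives in columns outside the index set and `X` in rows inside it.
Conjugation by `1 + X` is therefore left multiplication. -/
theorem IsRowOp.exists_mem_orbit {X : Matrix (Fin (k + l)) (Fin (k + l)) ℂ}
    (hX : IsRowOp k l lam X) (hdet : (1 + X).det ≠ 0) (A : conormalFiber k l lam) :
    ∃ A' ∈ MulAction.orbit (borelStab k l lam) A,
      Matrix.of A'.1 = (1 + X) * Matrix.of A.1 := by
  have hmem : (Matrix.of.symm ((1 + X) * Matrix.of A.1)) ∈ conormalFiber k l lam := by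
    refine mem_conormalFiber_iff.2 fun i j hij => ?_
    rw [add_mul, one_mul] at hij
    by_cases h0 : A.1 i j = 0
    · have : ∃ a, X i a * A.1 a j ≠ 0 := by
        by_contra! hall
        refine hij ?_
        change A.1 i j + (X * Matrix.of A.1) i j = 0
        rw [h0, zero_add, Matrix.mul_apply]
        exact Finset.sum_eq_zero fun a _ => hall a
      obtain ⟨a, ha⟩ := this
      have h1 := hX i a (left_ne_zero_of_mul ha)
      have h2 := inShape_of_ne A (right_ne_zero_of_mul ha)
      exact ⟨h1.1, h2.2.1, h1.2.2.trans_lt h2.2.2⟩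
    · exact inShape_of_ne A h0
  refine ⟨⟨_, hmem⟩, ?_, rfl⟩
  refine mem_orbit_of_mul_eq hdet ?_ ?_ (?_ : (1 + X) * Matrix.of A.1 * (1 + X) = _)
  · intro i j hij
    have : j < i := hij
    rw [Matrix.add_apply, Matrix.one_apply_ne this.ne', zero_add]
    by_contra hne
    exact absurd (hX i j hne).2.2 (not_le.2 this)
  · intro i hi j hj
    rw [Matrix.add_apply, Matrix.one_apply_ne (fun h : i = j => hi (h ▸ hj)), zero_add]
    by_contra hne
    exact hi (hX i j hne).1
  · have h0 : Matrix.of A.1 * X = 0 := by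
      ext i j
      rw [Matrix.mul_apply]
      refine Finset.sum_eq_zero fun a _ => ?_
      by_contra hne
      exact (inShape_of_ne A (left_ne_zero_of_mul hne)).2.1 (hX a j (right_ne_zero_of_mul hne)).1
    rw [mul_assoc, mul_add, mul_one, h0, add_zero]

/-- Dually `Y * A = 0`. Conjugation by `1 + Y` now takes `A * (1 + Y)` back to `A`, whence the
passage to the symmetric orbit relation. -/
theorem IsColOp.exists_mem_orbit {Y : Matrix (Fin (k + l)) (Fin (k + l)) ℂ}
    (hY : IsColOp k l lam Y) (hdet : (1 + Y).det ≠ 0) (A : conormalFiber k l lam) :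
    ∃ A' ∈ MulAction.orbit (borelStab k l lam) A,
      Matrix.of A'.1 = Matrix.of A.1 * (1 + Y) := by
  have hmem : (Matrix.of.symm (Matrix.of A.1 * (1 + Y))) ∈ conormalFiber k l lam := by
    refine mem_conormalFiber_iff.2 fun i j hij => ?_
    rw [mul_add, mul_one] at hij
    by_cases h0 : A.1 i j = 0
    · have : ∃ a, A.1 i a * Y a j ≠ 0 := by
        by_contra! hall
        refine hij ?_
        change A.1 i j + (Matrix.of A.1 * Y) i j = 0
        rw [h0, zero_add, Matrix.mul_apply]
        exact Finset.sum_eq_zero fun a _ => hall a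
      obtain ⟨a, ha⟩ := this
      have h1 := hY a j (right_ne_zero_of_mul ha)
      have h2 := inShape_of_ne A (left_ne_zero_of_mul ha)
      exact ⟨h2.1, h1.2.1, h2.2.2.trans_le h1.2.2⟩
    · exact inShape_of_ne A h0
  refine ⟨⟨_, hmem⟩, MulAction.mem_orbit_symm.1 ?_, rfl⟩
  refine mem_orbit_of_mul_eq hdet ?_ ?_
    (?_ : Matrix.of A.1 * (1 + Y) = (1 + Y) * (Matrix.of A.1 * (1 + Y)))
  · intro i j hij
    have : j < i := hij
    rw [Matrix.add_apply, Matrix.one_apply_ne this.ne', zero_add]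
    by_contra hne
    exact absurd (hY i j hne).2.2 (not_le.2 this)
  · intro i hi j hj
    rw [Matrix.add_apply, Matrix.one_apply_ne (fun h : i = j => hi (h ▸ hj)), zero_add]
    by_contra hne
    exact (hY i j hne).2.1 hj
  · have h0 : Y * Matrix.of A.1 = 0 := by
      ext i j
      rw [Matrix.mul_apply]
      refine Finset.sum_eq_zero fun a _ => ?_
      by_contra hne
      exact (hY i a (left_ne_zero_of_mul hne)).2.1 (inShape_of_ne A (right_ne_zero_of_mul hne)).1
    rw [← mul_assoc, add_mul, one_mul, h0, add_zero]

theorem exists_mem_orbit_of_ops {X Y : Matrix (Fin (k + l)) (Fin (k + l)) ℂ}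
    (hX : IsRowOp k l lam X) (hXdet : (1 + X).det ≠ 0)
    (hY : IsColOp k l lam Y) (hYdet : (1 + Y).det ≠ 0) (A : conormalFiber k l lam) :
    ∃ A' ∈ MulAction.orbit (borelStab k l lam) A,
      Matrix.of A'.1 = (1 + X) * Matrix.of A.1 * (1 + Y) := by
  obtain ⟨B, hB, hB'⟩ := hX.exists_mem_orbit hXdet A
  obtain ⟨C, hC, hC'⟩ := hY.exists_mem_orbit hYdet B
  refine ⟨C, ?_, by rw [hC', hB']⟩
  rwa [← MulAction.orbit_eq_iff.2 hB]

/-- The action of the diagonal torus. -/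
theorem mem_orbit_of_diagonal {t : Fin (k + l) → ℂ} (ht : ∀ i, t i ≠ 0)
    {A A' : conormalFiber k l lam} (h : ∀ i j, A'.1 i j * t j = t i * A.1 i j) :
    A' ∈ MulAction.orbit (borelStab k l lam) A := by
  refine mem_orbit_of_mul_eq (g := Matrix.diagonal t) ?_ (Matrix.blockTriangular_diagonal t) ?_ ?_
  · rw [Matrix.det_diagonal]
    exact Finset.prod_ne_zero_iff.2 fun i _ => ht i
  · intro i hi j hj
    exact Matrix.diagonal_apply_ne _ fun h => hi (h ▸ hj)
  · ext i j
    simpa using h i j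

/-! ### Elimination to rook matrices. -/

/-- Matrices with at most one non-zero entry in each row and column. -/
def IsRook (A : conormalFiber k l lam) : Prop :=
  ∀ i j, A.1 i j ≠ 0 → (∀ j', A.1 i j' ≠ 0 → j' = j) ∧ (∀ i', A.1 i' j ≠ 0 → i' = i)

theorem det_one_add_ne_zero_of_strict {n : ℕ} {X : Matrix (Fin n) (Fin n) ℂ}
    (hX : ∀ i j, X i j ≠ 0 → i < j) : (1 + X).det ≠ 0 := by
  have htri : (1 + X).BlockTriangular id := by
    intro i j hij
    have : j < i := hij
    rw [Matrix.add_apply, Matrix.one_apply_ne this.ne', zero_add]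
    by_contra hne
    exact absurd (hX i j hne) (not_lt.2 this.le)
  rw [Matrix.det_of_isUpperTriangular htri]
  refine Finset.prod_ne_zero_iff.2 fun i _ => ?_
  have : X i i = 0 := by
    by_contra hne
    exact lt_irrefl i (hX i i hne)
  simp [this]

/-- One step of the elimination: if the rows below `r` are in normal form, then so is `r` after
suitable row and column operations. -/
theorem exists_orbit_normal_row (B : conormalFiber k l lam) (r : Fin (k + l))
    (hB : ∀ i, r < i → ∀ j, B.1 i j ≠ 0 →
      (∀ j', B.1 i j' ≠ 0 → j' = j) ∧ (∀ i', B.1 i' j ≠ 0 → i' = i)) :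
    ∃ C ∈ MulAction.orbit (borelStab k l lam) B, ∀ i, r ≤ i → ∀ j, C.1 i j ≠ 0 →
      (∀ j', C.1 i j' ≠ 0 → j' = j) ∧ (∀ i', C.1 i' j ≠ 0 → i' = i) := by
  by_cases hr : ∀ j, B.1 r j = 0
  · refine ⟨B, MulAction.mem_orbit_self B, fun i hi j hij => ?_⟩
    refine hB i (lt_of_le_of_ne hi ?_) j hij
    rintro rfl
    exact hij (hr j)
  push Not at hr
  -- The pivot is the leftmost entry because columns may only be added to columns on their right.
  -- Likewise row `r` can only be used to clear the rows above it.
  obtain ⟨p, hp, hmin⟩ : ∃ p, B.1 r p ≠ 0 ∧ ∀ j, j < p → B.1 r j = 0 := by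
    obtain ⟨p, hp, hmin⟩ := wellFounded_lt.has_min {j | B.1 r j ≠ 0} hr
    exact ⟨p, hp, fun j hj => by_contra fun h => hmin j h hj⟩
  have hrp := inShape_of_ne B hp
  let X : Matrix (Fin (k + l)) (Fin (k + l)) ℂ :=
    Matrix.of fun i a => if a = r ∧ i < r then -(B.1 i p / B.1 r p) else 0
  let Y : Matrix (Fin (k + l)) (Fin (k + l)) ℂ :=
    Matrix.of fun b j => if b = p ∧ p < j then -(B.1 r j / B.1 r p) else 0
  have hXs : ∀ i a, X i a ≠ 0 → a = r ∧ i < r ∧ B.1 i p ≠ 0 := by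
    intro i a h
    by_cases hc : a = r ∧ i < r
    · refine ⟨hc.1, hc.2, fun h0 => h ?_⟩
      simp [X, h0]
    · exact absurd (by simp only [X, Matrix.of_apply, if_neg hc]) h
  have hYs : ∀ b j, Y b j ≠ 0 → b = p ∧ p < j ∧ B.1 r j ≠ 0 := by
    intro b j h
    by_cases hc : b = p ∧ p < j
    · refine ⟨hc.1, hc.2, fun h0 => h ?_⟩
      simp [Y, h0]
    · exact absurd (by simp only [Y, Matrix.of_apply, if_neg hc]) h
  have hX : IsRowOp k l lam X := by
    intro i a h
    obtain ⟨rfl, h1, h2⟩ := hXs i a h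
    exact ⟨(inShape_of_ne B h2).1, hrp.1, h1.le⟩
  have hY : IsColOp k l lam Y := by
    intro b j h
    obtain ⟨rfl, h1, h2⟩ := hYs b j h
    exact ⟨hrp.2.1, (inShape_of_ne B h2).2.1, h1.le⟩
  obtain ⟨C, hC, hCeq⟩ := exists_mem_orbit_of_ops hX
    (det_one_add_ne_zero_of_strict fun i a h => by
      obtain ⟨rfl, h1, -⟩ := hXs i a h
      exact h1) hY
    (det_one_add_ne_zero_of_strict fun b j h => by
      obtain ⟨rfl, h1, -⟩ := hYs b j h
      exact h1) B
  refine ⟨C, hC, ?_⟩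
  -- A non-zero entry below the pivot would be alone in its column by `hB`, contradicting the pivot
  -- itself.
  have hbelow : ∀ i, r < i → B.1 i p = 0 := fun i hi => by
    by_contra hne
    exact hi.ne ((hB i hi p hne).2 r hp)
  have hmid : ∀ i j, ((1 + X) * Matrix.of B.1) i j = B.1 i j + X i r * B.1 r j := by
    intro i j
    rw [add_mul, one_mul, Matrix.add_apply, Matrix.mul_apply,
      Finset.sum_eq_single r (fun a _ ha => ?_) (by simp)]
    · rfl
    · rw [show X i a = 0 by simp [X, ha], zero_mul]
  have hCij : ∀ i j, C.1 i j = (B.1 i j + X i r * B.1 r j) +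
      (B.1 i p + X i r * B.1 r p) * Y p j := by
    intro i j
    have : C.1 i j = ((1 + X) * Matrix.of B.1 * (1 + Y)) i j := congrFun (congrFun hCeq i) j
    rw [this, mul_add, mul_one, Matrix.add_apply, hmid, Matrix.mul_apply,
      Finset.sum_eq_single p (fun a _ ha => ?_) (by simp), hmid]
    rw [show Y a j = 0 by simp [Y, ha], mul_zero]
  have hpcol : ∀ i, i ≠ r → B.1 i p + X i r * B.1 r p = 0 := by
    intro i hi
    rcases lt_or_gt_of_ne hi with h | h
    · simp [X, h, hp]
    · rw [hbelow i h]
      simp [X, h.not_gt]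
  have hother : ∀ i, i ≠ r → ∀ j, C.1 i j = B.1 i j + X i r * B.1 r j := fun i hi j => by
    rw [hCij, hpcol i hi, zero_mul, add_zero]
  have hXr : X r r = 0 := by simp [X]
  have hrow : ∀ j, C.1 r j ≠ 0 → j = p := by
    intro j hj
    by_contra hjp
    refine hj ?_
    rw [hCij, hXr]
    rcases lt_or_gt_of_ne hjp with h | h
    · rw [hmin j h]
      simp [Y, h.not_gt]
    · simp only [Y, Matrix.of_apply, h, and_self, if_true]
      field_simp
      ring
  have hcol : ∀ i, C.1 i p ≠ 0 → i = r := by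
    intro i hi
    by_contra hir
    exact hi (by rw [hother i hir, hpcol i hir])
  intro i hi j hij
  rcases hi.eq_or_lt with rfl | hlt
  · obtain rfl := hrow j hij
    exact ⟨hrow, hcol⟩
  · have hXi : X i r = 0 := by simp [X, hlt.not_gt]
    have hCi : ∀ j, C.1 i j = B.1 i j := fun j => by rw [hother i hlt.ne', hXi]; simp
    rw [hCi] at hij
    obtain ⟨h1, h2⟩ := hB i hlt j hij
    refine ⟨fun j' hj' => h1 j' (by rwa [hCi] at hj'), fun i' hi' => ?_⟩
    have hrj : B.1 r j = 0 := by
      by_contra hne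
      exact hlt.ne (h2 r hne)
    by_cases hir : i' = r
    · subst hir
      obtain rfl := hrow j hi'
      exact absurd hrj hp
    · rw [hother i' hir, hrj, mul_zero, add_zero] at hi'
      exact h2 i' hi'

theorem exists_isRook_mem_orbit (A : conormalFiber k l lam) :
    ∃ B ∈ MulAction.orbit (borelStab k l lam) A, IsRook B := by
  -- Here `d` counts the rows at the bottom that are already in normal form.
  have key : ∀ d : ℕ, ∃ B ∈ MulAction.orbit (borelStab k l lam) A,
      ∀ i : Fin (k + l), k + l ≤ i + d → ∀ j, B.1 i j ≠ 0 →
        (∀ j', B.1 i j' ≠ 0 → j' = j) ∧ (∀ i', B.1 i' j ≠ 0 → i' = i) := by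
    intro d
    induction d with
    | zero => exact ⟨A, MulAction.mem_orbit_self A, fun i hi => absurd i.2 (not_lt.2 hi)⟩
    | succ d ih =>
      obtain ⟨B, hB, hBn⟩ := ih
      by_cases hd : d < k + l
      · obtain ⟨C, hC, hCn⟩ := exists_orbit_normal_row B ⟨k + l - (d + 1), by omega⟩
          (fun i hi => hBn i (by have := Fin.lt_def.1 hi; simp only at this; omega))
        refine ⟨C, by rwa [← MulAction.orbit_eq_iff.2 hB], fun i hi => hCn i ?_⟩
        rw [Fin.le_def]
        simp only
        omega
      · exact ⟨B, hB, fun i _ => hBn i (by omega)⟩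
  obtain ⟨B, hB, hBn⟩ := key (k + l)
  exact ⟨B, hB, fun i => hBn i (by omega)⟩

/-! ### Uncovered positions and the transverse slice. -/

/-- The position `(i, j)` is not reached by the infinitesimal action at `A`: there is no non-zero
entry weakly to the left of it in row `i`, nor weakly below it in column `j`. -/
def Uncovered (A : conormalFiber k l lam) (i j : Fin (k + l)) : Prop :=
  InShape k l lam i j ∧ (∀ j' ≤ j, A.1 i j' = 0) ∧ ∀ i' ≥ i, A.1 i' j = 0

/-- The uncovered positions. -/
abbrev UncoveredPos (A : conormalFiber k l lam) : Type :=
  {u : Fin (k + l) × Fin (k + l) // Uncovered A u.1 u.2}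

section Slice

variable {A : conormalFiber k l lam} {c : ℕ}

open Classical in
/-- The matrix with the given entries at the uncovered positions. -/
def slicePart (e : Fin c ≃ UncoveredPos A) (y : Fin c → ℂ) : conormalFiber k l lam :=
  ⟨fun i j => if h : Uncovered A i j then y (e.symm ⟨(i, j), h⟩) else 0, by
    refine mem_conormalFiber_iff.2 fun i j hij => ?_
    by_cases h : Uncovered A i j
    · exact h.1
    · exact absurd (dif_neg h) hij⟩

theorem slicePart_apply (e : Fin c ≃ UncoveredPos A) (y : Fin c → ℂ) (s : Fin c) :
    (slicePart e y).1 (e s).1.1 (e s).1.2 = y s := by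
  simp only [slicePart]
  rw [dif_pos (e s).2]
  congr 1
  exact e.symm_apply_apply s

theorem slicePart_apply_of_not (e : Fin c ≃ UncoveredPos A) (y : Fin c → ℂ)
    {i j : Fin (k + l)} (h : ¬ Uncovered A i j) : (slicePart e y).1 i j = 0 :=
  dif_neg h

theorem exists_of_slicePart_ne (e : Fin c ≃ UncoveredPos A) {y : Fin c → ℂ}
    {i j : Fin (k + l)} (h : (slicePart e y).1 i j ≠ 0) :
    ∃ s, (e s).1 = (i, j) ∧ y s ≠ 0 := by
  by_cases hu : Uncovered A i j
  · refine ⟨e.symm ⟨(i, j), hu⟩, by simp, ?_⟩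
    simpa only [slicePart, dif_pos hu] using h
  · exact absurd (slicePart_apply_of_not e y hu) h

/-- The entries of a matrix at the uncovered positions. -/
def sliceCoord (e : Fin c ≃ UncoveredPos A) : conormalFiber k l lam →L[ℂ] (Fin c → ℂ) :=
  LinearMap.toContinuousLinearMap
    { toFun := fun B s => B.1 (e s).1.1 (e s).1.2
      map_add' := fun _ _ => rfl
      map_smul' := fun _ _ => rfl }

theorem sliceCoord_apply (e : Fin c ≃ UncoveredPos A) (B : conormalFiber k l lam) (s : Fin c) :
    sliceCoord e B s = B.1 (e s).1.1 (e s).1.2 := rfl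

theorem sliceCoord_slicePart (e : Fin c ≃ UncoveredPos A) (y : Fin c → ℂ) :
    sliceCoord e (slicePart e y) = y := by
  ext s
  rw [sliceCoord_apply, slicePart_apply]

theorem slicePart_zero (e : Fin c ≃ UncoveredPos A) : slicePart e 0 = 0 := by
  apply Subtype.ext
  ext i j
  by_contra h
  obtain ⟨s, -, hs⟩ := exists_of_slicePart_ne e h
  exact hs rfl

theorem slicePart_sliceCoord_of_uncovered (e : Fin c ≃ UncoveredPos A) (B : conormalFiber k l lam)
    {i j : Fin (k + l)} (h : Uncovered A i j) : (slicePart e (sliceCoord e B)).1 i j = B.1 i j := by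
  simp only [slicePart, dif_pos h, sliceCoord_apply, Equiv.apply_symm_apply]

open Classical in
/-- The column operation whose infinitesimal effect on `A` is the part of `B` at the positions with
a non-zero entry of `A` weakly to the left. -/
def colOp (A B : conormalFiber k l lam) : Matrix (Fin (k + l)) (Fin (k + l)) ℂ :=
  Matrix.of fun b j => ∑ i, if b ≤ j then B.1 i j * (A.1 i b)⁻¹ else 0

open Classical in
/-- The row operation whose infinitesimal effect on `A` is the part of `B` at the positions with
a non-zero entry of `A` weakly below, but none weakly to the left. -/
def rowOp (A B : conormalFiber k l lam) : Matrix (Fin (k + l)) (Fin (k + l)) ℂ :=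
  Matrix.of fun i a => ∑ j, if i ≤ a ∧ ∀ j' ≤ j, A.1 i j' = 0 then B.1 i j * (A.1 a j)⁻¹ else 0

theorem isColOp_colOp (A B : conormalFiber k l lam) : IsColOp k l lam (colOp A B) := by
  intro b j h
  rw [colOp, Matrix.of_apply] at h
  obtain ⟨i, -, hi⟩ := Finset.exists_ne_zero_of_sum_ne_zero h
  split_ifs at hi with hc
  · exact ⟨(inShape_of_ne A fun h0 => hi (by rw [h0, inv_zero, mul_zero])).2.1,
      (inShape_of_ne B (left_ne_zero_of_mul hi)).2.1, hc⟩
  · exact absurd rfl hi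

theorem isRowOp_rowOp (A B : conormalFiber k l lam) : IsRowOp k l lam (rowOp A B) := by
  intro i a h
  rw [rowOp, Matrix.of_apply] at h
  obtain ⟨j, -, hj⟩ := Finset.exists_ne_zero_of_sum_ne_zero h
  split_ifs at hj with hc
  · exact ⟨(inShape_of_ne B (left_ne_zero_of_mul hj)).1,
      (inShape_of_ne A fun h0 => hj (by rw [h0, inv_zero, mul_zero])).1, hc.1⟩
  · exact absurd rfl hj

-- The convention `0⁻¹ = 0` reduces the sum in `colOp` to the one possible non-zero entry in column
-- `b` of the rook matrix, and multiplication by `A` cancels that entry.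
open Classical in
theorem mul_colOp_apply (hA : IsRook A) (B : conormalFiber k l lam) (i j : Fin (k + l)) :
    (Matrix.of A.1 * colOp A B) i j = if ∃ b ≤ j, A.1 i b ≠ 0 then B.1 i j else 0 := by
  rw [Matrix.mul_apply]
  split_ifs with h
  · obtain ⟨b, hb, hne⟩ := h
    rw [Finset.sum_eq_single b (fun b' _ hb' => ?_) (by simp)]
    · simp only [colOp, Matrix.of_apply]
      rw [Finset.sum_eq_single i (fun i' _ hi' => ?_) (by simp)]
      · rw [if_pos hb]
        field_simp
      · have : A.1 i' b = 0 := by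
          by_contra h0
          exact hi' ((hA i b hne).2 i' h0)
        simp [this]
    · have : A.1 i b' = 0 := by
        by_contra h0
        exact hb' ((hA i b hne).1 b' h0)
      simp [this]
  · push Not at h
    refine Finset.sum_eq_zero fun b _ => ?_
    by_cases hb : b ≤ j
    · simp [h b hb]
    · simp [colOp, hb]

open Classical in
theorem rowOp_mul_apply (hA : IsRook A) (B : conormalFiber k l lam) (i j : Fin (k + l)) :
    (rowOp A B * Matrix.of A.1) i j =
      if (∀ j' ≤ j, A.1 i j' = 0) ∧ ∃ a ≥ i, A.1 a j ≠ 0 then B.1 i j else 0 := by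
  have hterm : ∀ a, rowOp A B i a * Matrix.of A.1 a j =
      if (i ≤ a ∧ ∀ j' ≤ j, A.1 i j' = 0) ∧ A.1 a j ≠ 0 then B.1 i j else 0 := by
    intro a
    by_cases h0 : A.1 a j = 0
    · simp [h0]
    · simp only [rowOp, Matrix.of_apply]
      rw [Finset.sum_eq_single j (fun j' _ hj' => ?_) (by simp)]
      · simp only [h0, ne_eq, not_false_eq_true, and_true]
        split_ifs
        · field_simp
        · simp
      · have : A.1 a j' = 0 := by
          by_contra h1
          exact hj' ((hA a j h0).1 j' h1)
        simp [this]
  rw [Matrix.mul_apply, Finset.sum_congr rfl fun a _ => hterm a]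
  split_ifs with h
  · obtain ⟨hl, a, ha, hne⟩ := h
    rw [Finset.sum_eq_single a (fun a' _ ha' => ?_) (by simp)]
    · rw [if_pos ⟨⟨ha, hl⟩, hne⟩]
    · refine if_neg fun h => ha' ?_
      exact (hA a j hne).2 a' h.2
  · refine Finset.sum_eq_zero fun a _ => if_neg fun h' => h ⟨h'.1.2, a, h'.1.1, h'.2⟩

/-- The infinitesimal action at a rook matrix reaches all covered positions. -/
theorem rowOp_mul_add_mul_colOp (hA : IsRook A) (e : Fin c ≃ UncoveredPos A)
    (B : conormalFiber k l lam) :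
    rowOp A B * Matrix.of A.1 + Matrix.of (slicePart e (sliceCoord e B)).1 +
      Matrix.of A.1 * colOp A B = Matrix.of B.1 := by
  ext i j
  rw [Matrix.add_apply, Matrix.add_apply, mul_colOp_apply hA, rowOp_mul_apply hA]
  simp only [Matrix.of_apply]
  -- The three summands have disjoint supports: positions covered from the left, those covered only
  -- from below, and the uncovered ones. The second clause in `rowOp` prevents double counting.
  by_cases hB : InShape k l lam i j
  · by_cases h1 : ∃ b ≤ j, A.1 i b ≠ 0
    · have h1' : ¬ ∀ j' ≤ j, A.1 i j' = 0 := by push Not; exact h1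
      have h2 : ¬ Uncovered A i j := fun h => h1' h.2.1
      simp only [h1, h1', false_and, if_false, if_true, slicePart_apply_of_not e _ h2, zero_add]
    · have h1' : ∀ j' ≤ j, A.1 i j' = 0 := by push Not at h1; exact h1
      by_cases h2 : ∃ a ≥ i, A.1 a j ≠ 0
      · have h3 : ¬ Uncovered A i j := fun h => by
          obtain ⟨a, ha, hne⟩ := h2
          exact hne (h.2.2 a ha)
        rw [if_neg h1, if_pos ⟨h1', h2⟩, slicePart_apply_of_not e _ h3, add_zero, add_zero]
      · have h3 : Uncovered A i j := ⟨hB, h1', by push Not at h2; exact h2⟩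
        rw [if_neg h1, if_neg fun h => h2 h.2, slicePart_sliceCoord_of_uncovered e B h3, zero_add,
          add_zero]
  · have h0 : B.1 i j = 0 := by
      by_contra h
      exact hB (inShape_of_ne B h)
    rw [slicePart_apply_of_not e _ fun h => hB h.1, h0]
    simp

-- A submultiplicative norm makes products of matrices analytic and gives the product rule.
attribute [local instance] Matrix.linftyOpNormedRing Matrix.linftyOpNormedAlgebra

/-- `colOp` as a continuous linear map. -/
def colOpL (A : conormalFiber k l lam) :
    conormalFiber k l lam →L[ℂ] Matrix (Fin (k + l)) (Fin (k + l)) ℂ :=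
  LinearMap.toContinuousLinearMap
    { toFun := colOp A
      map_add' := fun B C => by
        ext b j
        simp only [colOp, Matrix.of_apply, Matrix.add_apply, ← Finset.sum_add_distrib]
        refine Finset.sum_congr rfl fun i _ => ?_
        split_ifs
        · exact add_mul _ _ _
        · simp
      map_smul' := fun r B => by
        ext b j
        simp only [colOp, Matrix.of_apply, Matrix.smul_apply, smul_eq_mul, Finset.mul_sum,
          RingHom.id_apply]
        refine Finset.sum_congr rfl fun i _ => ?_
        split_ifs
        · exact mul_assoc _ _ _
        · simp }

/-- `rowOp` as a continuous linear map. -/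
def rowOpL (A : conormalFiber k l lam) :
    conormalFiber k l lam →L[ℂ] Matrix (Fin (k + l)) (Fin (k + l)) ℂ :=
  LinearMap.toContinuousLinearMap
    { toFun := rowOp A
      map_add' := fun B C => by
        ext b j
        simp only [rowOp, Matrix.of_apply, Matrix.add_apply, ← Finset.sum_add_distrib]
        refine Finset.sum_congr rfl fun i _ => ?_
        split_ifs
        · exact add_mul _ _ _
        · simp
      map_smul' := fun r B => by
        ext b j
        simp only [rowOp, Matrix.of_apply, Matrix.smul_apply, smul_eq_mul, Finset.mul_sum,
          RingHom.id_apply]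
        refine Finset.sum_congr rfl fun i _ => ?_
        split_ifs
        · exact mul_assoc _ _ _
        · simp }

/-- The part of a matrix at the uncovered positions, as a continuous linear map. -/
def slicePartL (e : Fin c ≃ UncoveredPos A) :
    conormalFiber k l lam →L[ℂ] Matrix (Fin (k + l)) (Fin (k + l)) ℂ :=
  LinearMap.toContinuousLinearMap
    { toFun := fun B => Matrix.of (slicePart e (sliceCoord e B)).1
      map_add' := fun B C => by
        ext i j
        simp only [slicePart, Matrix.of_apply, Matrix.add_apply, map_add, Pi.add_apply]
        split_ifs <;> simp
      map_smul' := fun r B => by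
        ext i j
        simp only [slicePart, Matrix.of_apply, Matrix.smul_apply, map_smul, Pi.smul_apply,
          RingHom.id_apply]
        split_ifs <;> simp }

open Classical in
/-- The projection of all matrices to `M_lam` that sets the entries outside the shape to zero. -/
def shapeProj (k l : ℕ) (lam : YoungDiagram) :
    Matrix (Fin (k + l)) (Fin (k + l)) ℂ →L[ℂ] conormalFiber k l lam :=
  LinearMap.toContinuousLinearMap
    { toFun := fun M => ⟨fun i j => if InShape k l lam i j then M i j else 0,
        mem_conormalFiber_iff.2 fun i j h => by
          by_contra hs
          exact h (if_neg hs)⟩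
      map_add' := fun M N => by
        apply Subtype.ext
        ext i j
        change (if InShape k l lam i j then M i j + N i j else 0) =
          (if InShape k l lam i j then M i j else 0) + if InShape k l lam i j then N i j else 0
        split_ifs <;> simp
      map_smul' := fun r M => by
        apply Subtype.ext
        ext i j
        change (if InShape k l lam i j then r * M i j else 0) =
          r * if InShape k l lam i j then M i j else 0
        split_ifs <;> simp }

open Classical in
theorem shapeProj_of (B : conormalFiber k l lam) : shapeProj k l lam (Matrix.of B.1) = B := by
  apply Subtype.ext
  ext i j
  change (if InShape k l lam i j then B.1 i j else 0) = _
  split_ifs with h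
  · rfl
  · by_contra hne
    exact h (inShape_of_ne B (Ne.symm hne))

/-- Moving the slice through `A` by row and column operations parametrizes a neighbourhood of
`A`. -/
def sliceMap (e : Fin c ≃ UncoveredPos A) (B : conormalFiber k l lam) : conormalFiber k l lam :=
  shapeProj k l lam
    ((1 + rowOpL A B) * (Matrix.of A.1 + slicePartL e B) * (1 + colOpL A B))

theorem sliceMap_zero (e : Fin c ≃ UncoveredPos A) : sliceMap e 0 = A := by
  rw [sliceMap]
  simp only [map_zero, add_zero, one_mul, mul_one]
  exact shapeProj_of A

theorem analyticAt_sliceMap (e : Fin c ≃ UncoveredPos A) (B : conormalFiber k l lam) :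
    AnalyticAt ℂ (sliceMap e) B := by
  refine ((shapeProj k l lam).analyticAt _).comp ?_
  refine ((analyticAt_const.add ((rowOpL A).analyticAt _)).mul
    (analyticAt_const.add ((slicePartL e).analyticAt _))).mul
    (analyticAt_const.add ((colOpL A).analyticAt _))

/-- The product rule at `0` gives `rowOp A B * A + slicePart + A * colOp A B`, which is the
decomposition of `B` in `rowOp_mul_add_mul_colOp`. -/
theorem hasFDerivAt_sliceMap (hA : IsRook A) (e : Fin c ≃ UncoveredPos A) :
    HasFDerivAt (sliceMap e) (ContinuousLinearMap.id ℂ (conormalFiber k l lam)) 0 := by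
  have h := (shapeProj k l lam).hasFDerivAt.comp (0 : conormalFiber k l lam)
    ((((rowOpL A).hasFDerivAt (x := 0)).const_add 1).mul'
      (((slicePartL e).hasFDerivAt (x := 0)).const_add (Matrix.of A.1)) |>.mul'
      (((colOpL A).hasFDerivAt (x := 0)).const_add 1))
  refine h.congr_fderiv ?_
  ext1 B
  have hkey : rowOpL A B * Matrix.of A.1 + slicePartL e B + Matrix.of A.1 * colOpL A B =
    Matrix.of B.1 := rowOp_mul_add_mul_colOp hA e B
  have := shapeProj_of B
  rw [← hkey] at this
  refine Eq.trans (congrArg (shapeProj k l lam) ?_) this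
  change (1 + rowOpL A 0) * (Matrix.of A.1 + slicePartL e 0) * colOpL A B +
    ((1 + rowOpL A 0) * slicePartL e B + rowOpL A B * (Matrix.of A.1 + slicePartL e 0)) *
      (1 + colOpL A 0) = _
  simp only [map_zero, add_zero, one_mul, mul_one]
  abel

theorem mem_orbit_sliceMap (e : Fin c ≃ UncoveredPos A) {B : conormalFiber k l lam}
    (h1 : (1 + rowOpL A B).det ≠ 0) (h2 : (1 + colOpL A B).det ≠ 0) :
    sliceMap e B ∈
      MulAction.orbit (borelStab k l lam) (A + slicePart e (sliceCoord e B)) := by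
  obtain ⟨C, hC, hCeq⟩ := exists_mem_orbit_of_ops (isRowOp_rowOp A B) h1 (isColOp_colOp A B) h2
    (A + slicePart e (sliceCoord e B))
  have : sliceMap e B = C := by
    rw [← shapeProj_of C, hCeq]
    rfl
  rwa [this]

/-- Near a rook matrix `A` there are analytic coordinates transverse to its orbit, with values in
the slice of matrices that differ from `A` only at the uncovered positions. -/
theorem exists_sliceProj (hA : IsRook A) (e : Fin c ≃ UncoveredPos A) :
    ∃ f : conormalFiber k l lam → (Fin c → ℂ), AnalyticAt ℂ f A ∧
      Function.Surjective (fderiv ℂ f A) ∧ f A = 0 ∧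
      ∀ᶠ B in 𝓝 A, B ∈ MulAction.orbit (borelStab k l lam) (A + slicePart e (f B)) := by
  have han := analyticAt_sliceMap e (0 : conormalFiber k l lam)
  have hd : fderiv ℂ (sliceMap e) 0 =
      ((ContinuousLinearEquiv.refl ℂ (conormalFiber k l lam) :
        conormalFiber k l lam ≃L[ℂ] conormalFiber k l lam) :
        conormalFiber k l lam →L[ℂ] conormalFiber k l lam) :=
    (hasFDerivAt_sliceMap hA e).fderiv
  have hstrict := han.hasStrictFDerivAt
  rw [hd] at hstrict
  have hψan : AnalyticAt ℂ (hstrict.localInverse _ _ _) (sliceMap e 0) :=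
    (hstrict.toOpenPartialHomeomorph (sliceMap e)).analyticAt_symm'
      hstrict.mem_toOpenPartialHomeomorph_source han hd
  have hψd := hstrict.to_localInverse
  have hψ0 := hstrict.localInverse_apply_image
  have hinv := hstrict.eventually_right_inverse
  have ht := hstrict.localInverse_tendsto
  set ψ := hstrict.localInverse _ _ _
  rw [sliceMap_zero] at hψan hψd hψ0 hinv ht
  -- The projection is the slice coordinate of the local inverse of `sliceMap`. Its differential at
  -- `A` is `sliceCoord`, with section `slicePart`.
  refine ⟨fun B => sliceCoord e (ψ B), ?_, ?_, ?_, ?_⟩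
  · exact ((sliceCoord e).analyticAt _).comp hψan
  · have h' : fderiv ℂ (fun B => sliceCoord e (ψ B)) A = _ :=
      ((sliceCoord e).hasFDerivAt.comp A hψd.hasFDerivAt).fderiv
    rw [h']
    intro y
    exact ⟨slicePart e y, by simp [sliceCoord_slicePart]⟩
  · simp only [hψ0, map_zero]
  · have hdet : ∀ L : conormalFiber k l lam →L[ℂ] Matrix (Fin (k + l)) (Fin (k + l)) ℂ,
        ∀ᶠ B in 𝓝 (0 : conormalFiber k l lam), (1 + L B).det ≠ 0 := by
      intro L
      have hc : Continuous fun B => (1 + L B).det :=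
        (continuous_const.add L.continuous).matrix_det
      exact hc.continuousAt.eventually_ne (by simp)
    filter_upwards [hinv, ht.eventually (hdet (rowOpL A)), ht.eventually (hdet (colOpL A))]
      with B h1 h2 h3
    have := mem_orbit_sliceMap e h2 h3
    rwa [h1] at this

end Slice

/-! ### Ranks of lower left blocks as orbit invariants. -/

/-- The part of a matrix in the rows from `i` on and the columns up to `j`. -/
def lowerLeft {n : ℕ} (i j : Fin n) (M : Matrix (Fin n) (Fin n) ℂ) : Matrix (Fin n) (Fin n) ℂ :=
  Matrix.diagonal (fun a => if i ≤ a then 1 else 0) * M *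
    Matrix.diagonal (fun b => if b ≤ j then 1 else 0)

theorem lowerLeft_apply {n : ℕ} (i j : Fin n) (M : Matrix (Fin n) (Fin n) ℂ) (a b : Fin n) :
    lowerLeft i j M a b = if i ≤ a ∧ b ≤ j then M a b else 0 := by
  rw [lowerLeft, Matrix.mul_diagonal, Matrix.diagonal_mul]
  by_cases h1 : i ≤ a <;> by_cases h2 : b ≤ j <;> simp [h1, h2]

/-- For triangular factors, the rows from `i` on of `g * M` depend only on those rows of `M`, and
the columns up to `j` of `M * h` only on those columns. The new block is thus a product with the old
block as a factor. -/
theorem rank_lowerLeft_mul_le {n : ℕ} (i j : Fin n) {g h : Matrix (Fin n) (Fin n) ℂ}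
    (hg : g.BlockTriangular id) (hh : h.BlockTriangular id) (M : Matrix (Fin n) (Fin n) ℂ) :
    (lowerLeft i j (g * M * h)).rank ≤ (lowerLeft i j M).rank := by
  set D : Matrix (Fin n) (Fin n) ℂ := Matrix.diagonal (fun a => if i ≤ a then 1 else 0) with hD
  set D' : Matrix (Fin n) (Fin n) ℂ := Matrix.diagonal (fun b => if b ≤ j then 1 else 0) with hD'
  have h1 : D * g = D * g * D := by
    ext a b
    rw [hD, Matrix.mul_diagonal, Matrix.diagonal_mul]
    by_cases ha : i ≤ a
    · by_cases hb : i ≤ b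
      · simp [hb]
      · have hlt : b < a := lt_of_lt_of_le (not_le.1 hb) ha
        simp [hg (show id b < id a from hlt)]
    · simp [ha]
  have h2 : h * D' = D' * h * D' := by
    ext a b
    rw [hD', Matrix.mul_diagonal, Matrix.mul_diagonal, Matrix.diagonal_mul]
    by_cases hb : b ≤ j
    · by_cases ha : a ≤ j
      · simp [ha]
      · have hlt : b < a := lt_of_le_of_lt hb (not_le.1 ha)
        simp [hh (show id b < id a from hlt)]
    · simp [hb]
  have h3 : lowerLeft i j (g * M * h) = D * g * lowerLeft i j M * (h * D') := by
    change D * (g * M * h) * D' = D * g * (D * M * D') * (h * D')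
    calc D * (g * M * h) * D' = (D * g) * M * (h * D') := by simp only [mul_assoc]
      _ = (D * g * D) * M * (D' * h * D') := by rw [← h1, ← h2]
      _ = D * g * (D * M * D') * (h * D') := by simp only [mul_assoc]
  rw [h3]
  exact (Matrix.rank_mul_le_left _ _).trans (Matrix.rank_mul_le_right _ _)

theorem rank_lowerLeft_eq_of_mem_orbit {A B : conormalFiber k l lam}
    (h : A ∈ MulAction.orbit (borelStab k l lam) B) (i j : Fin (k + l)) :
    (lowerLeft i j (Matrix.of A.1)).rank = (lowerLeft i j (Matrix.of B.1)).rank := by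
  have key : ∀ {A B : conormalFiber k l lam}, A ∈ MulAction.orbit (borelStab k l lam) B →
      (lowerLeft i j (Matrix.of A.1)).rank ≤ (lowerLeft i j (Matrix.of B.1)).rank := by
    rintro _ B ⟨g, rfl⟩
    exact rank_lowerLeft_mul_le i j g.2.1 (inv_mem g.2.1) (Matrix.of B.1)
  exact le_antisymm (key h) (key (MulAction.mem_orbit_symm.1 h))

theorem rank_lt_rank_add_single {n : ℕ} (i j : Fin n) {M : Matrix (Fin n) (Fin n) ℂ}
    (hrow : ∀ b, M i b = 0) (hcol : ∀ a, M a j = 0) {x : ℂ} (hx : x ≠ 0) :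
    M.rank < (M + Matrix.single i j x).rank := by
  refine Submodule.finrank_lt_finrank_of_lt ?_
  refine lt_of_le_of_ne ?_ ?_
  · rintro _ ⟨v, rfl⟩
    -- Dropping coordinate `j` does not change `M v`, as column `j` of `M` is zero, and it kills the
    -- contribution of the added entry.
    refine ⟨v - Pi.single j (v j), ?_⟩
    rw [Matrix.mulVecLin_apply, Matrix.mulVecLin_apply, Matrix.add_mulVec, Matrix.single_mulVec,
      Matrix.mulVec_sub]
    ext a
    simp [hcol]
  · intro heq
    have hmem : (M + Matrix.single i j x).mulVec (Pi.single j 1) ∈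
        LinearMap.range (M + Matrix.single i j x).mulVecLin := ⟨_, rfl⟩
    rw [← heq] at hmem
    obtain ⟨v, hv⟩ := hmem
    have := congrFun hv i
    rw [Matrix.mulVecLin_apply, Matrix.add_mulVec, Matrix.single_mulVec] at this
    simp [Matrix.mulVec, dotProduct, hrow] at this
    exact hx this.symm

section Invariants

variable {A : conormalFiber k l lam} {c : ℕ} (e : Fin c ≃ UncoveredPos A)

/-- The position `u'` lies weakly below and to the left of `u`. -/
def IsLowerLeft {n : ℕ} (u' u : Fin n × Fin n) : Prop := u.1 ≤ u'.1 ∧ u'.2 ≤ u.2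

theorem lowerLeft_slice {y : Fin c → ℂ} {s : Fin c}
    (hy : ∀ s', s' ≠ s → IsLowerLeft (e s').1 (e s).1 → y s' = 0) :
    lowerLeft (e s).1.1 (e s).1.2 (Matrix.of (A + slicePart e y).1) =
      lowerLeft (e s).1.1 (e s).1.2 (Matrix.of A.1) +
        Matrix.single (e s).1.1 (e s).1.2 (y s) := by
  ext a b
  rw [Matrix.add_apply, lowerLeft_apply, lowerLeft_apply]
  change (if _ then A.1 a b + (slicePart e y).1 a b else 0) = _
  by_cases hab : a = (e s).1.1 ∧ b = (e s).1.2
  · obtain ⟨rfl, rfl⟩ := hab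
    simp [slicePart_apply]
  · rw [Matrix.single_apply_of_ne _ _ _ _ _ fun h => hab ⟨h.1.symm, h.2.symm⟩, add_zero]
    split_ifs with h
    · have : (slicePart e y).1 a b = 0 := by
        by_contra hne
        obtain ⟨s', hs', hys'⟩ := exists_of_slicePart_ne e hne
        refine hys' (hy s' ?_ ?_)
        · rintro rfl
          exact hab (by simp [hs'])
        · simpa [IsLowerLeft, hs'] using h
      rw [this, add_zero, Matrix.of_apply]
    · rfl

/-- An uncovered position has empty row and column inside its own lower left block of `A`, so a
non-zero value there raises the rank. -/
theorem rank_lowerLeft_slice_eq_iff {y : Fin c → ℂ} {s : Fin c}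
    (hy : ∀ s', s' ≠ s → IsLowerLeft (e s').1 (e s).1 → y s' = 0) :
    (lowerLeft (e s).1.1 (e s).1.2 (Matrix.of (A + slicePart e y).1)).rank =
      (lowerLeft (e s).1.1 (e s).1.2 (Matrix.of A.1)).rank ↔ y s = 0 := by
  rw [lowerLeft_slice e hy]
  constructor
  · intro h
    by_contra hne
    refine (rank_lt_rank_add_single (e s).1.1 (e s).1.2 (fun b => ?_) (fun a => ?_) hne).ne' h
    · rw [lowerLeft_apply]
      split_ifs with hb
      · exact (e s).2.2.1 b hb.2
      · rfl
    · rw [lowerLeft_apply]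
      split_ifs with ha
      · exact (e s).2.2.2 a ha.1
      · rfl
  · intro h
    rw [h, Matrix.single_zero, add_zero]

theorem coord_eq_zero_iff_of_mem_orbit {y z : Fin c → ℂ}
    (h : A + slicePart e y ∈ MulAction.orbit (borelStab k l lam) (A + slicePart e z)) {s : Fin c}
    (hy : ∀ s', s' ≠ s → IsLowerLeft (e s').1 (e s).1 → y s' = 0)
    (hz : ∀ s', s' ≠ s → IsLowerLeft (e s').1 (e s).1 → z s' = 0) : y s = 0 ↔ z s = 0 := by
  rw [← rank_lowerLeft_slice_eq_iff e hy, ← rank_lowerLeft_slice_eq_iff e hz,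
    rank_lowerLeft_eq_of_mem_orbit h]

theorem eq_of_isLowerLeft {n : ℕ} {u v : Fin n × Fin n} (h : IsLowerLeft u v)
    (h' : IsLowerLeft v u) : u = v :=
  Prod.ext (le_antisymm h'.1 h.1) (le_antisymm h.2 h'.2)

/-- The slice meets the orbit of `A` only in `A`. -/
theorem eq_zero_of_mem_orbit {y : Fin c → ℂ}
    (h : A + slicePart e y ∈ MulAction.orbit (borelStab k l lam) (A + slicePart e 0)) : y = 0 := by
  by_contra hne
  obtain ⟨s₀, hs₀⟩ := Function.ne_iff.1 hne
  -- Column minus row strictly decreases towards the lower left, so a minimizer among the non-zero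
  -- coordinates has no other one in its block and is visible to the rank.
  obtain ⟨s, hs, hmin⟩ := Finset.exists_min_image (Finset.univ.filter fun s => y s ≠ 0)
    (fun s => ((e s).1.2 : ℤ) - ((e s).1.1 : ℤ)) ⟨s₀, by simpa using hs₀⟩
  rw [Finset.mem_filter] at hs
  refine hs.2 ((coord_eq_zero_iff_of_mem_orbit e h (fun s' hne' hs' => ?_)
    fun _ _ _ => rfl).2 rfl)
  by_contra hy
  have h1 := hmin s' (by simpa using hy)
  have h2 := Fin.le_def.1 hs'.1
  have h3 := Fin.le_def.1 hs'.2
  refine hne' (e.injective (Subtype.ext (Prod.ext (Fin.ext ?_) (Fin.ext ?_)))) <;> omega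

/-- Two different coordinate axes of the slice lie in different orbits. -/
theorem single_not_mem_orbit {s t : Fin c} (hst : s ≠ t) :
    A + slicePart e (Pi.single s 1) ∉
      MulAction.orbit (borelStab k l lam) (A + slicePart e (Pi.single t 1)) := by
  -- The block at `s` distinguishes the axes when it does not contain position `t`. Two different
  -- positions cannot each lie in the block of the other, so one of the two blocks works.
  have key : ∀ {s t : Fin c}, s ≠ t → ¬ IsLowerLeft (e t).1 (e s).1 →
      A + slicePart e (Pi.single s 1) ∉
        MulAction.orbit (borelStab k l lam) (A + slicePart e (Pi.single t 1)) := by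
    intro s t hst hnot h
    have := coord_eq_zero_iff_of_mem_orbit e h (s := s)
      (fun s' hs' _ => Pi.single_eq_of_ne hs' 1) (fun s' _ hl => ?_)
    · simp [hst] at this
    · by_cases hs't : s' = t
      · exact absurd (hs't ▸ hl) hnot
      · exact Pi.single_eq_of_ne hs't 1
  by_cases hl : IsLowerLeft (e t).1 (e s).1
  · have hl' : ¬ IsLowerLeft (e s).1 (e t).1 := fun hl' =>
      hst (e.injective (Subtype.ext (eq_of_isLowerLeft hl' hl)))
    exact fun h => key hst.symm hl' (MulAction.mem_orbit_symm.1 h)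
  · exact key hst hl

end Invariants

/-! ### Torus rescaling of the slice coordinates. -/

/-- Two indices are linked if they are equal or the row and column of a non-zero entry. -/
def Linked (A : conormalFiber k l lam) (a b : Fin (k + l)) : Prop :=
  a = b ∨ A.1 a b ≠ 0 ∨ A.1 b a ≠ 0

theorem Linked.symm {A : conormalFiber k l lam} {a b : Fin (k + l)} (h : Linked A a b) :
    Linked A b a := by
  rcases h with h | h | h
  · exact Or.inl h.symm
  · exact Or.inr (Or.inr h)
  · exact Or.inr (Or.inl h)

/-- The non-zero entries of a rook matrix form a partial matching between the index set and its
complement, so each class has at most two elements. -/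
theorem Linked.trans {A : conormalFiber k l lam} (hA : IsRook A) {a b d : Fin (k + l)}
    (h : Linked A a b) (h' : Linked A b d) : Linked A a d := by
  rcases h with rfl | h | h
  · exact h'
  · rcases h' with rfl | h' | h'
    · exact Or.inr (Or.inl h)
    · exact absurd (inShape_of_ne A h').1 (inShape_of_ne A h).2.1
    · exact Or.inl ((hA d b h').2 a h)
  · rcases h' with rfl | h' | h'
    · exact Or.inr (Or.inr h)
    · exact Or.inl ((hA b d h').1 a h)
    · exact absurd (inShape_of_ne A h).1 (inShape_of_ne A h').2.1

theorem Linked.eq_of_mem {A : conormalFiber k l lam} {a b : Fin (k + l)} (h : Linked A a b)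
    (hab : a ∈ indexSet k l lam ↔ b ∈ indexSet k l lam) : a = b := by
  rcases h with h | h | h
  · exact h
  · exact absurd (hab.1 (inShape_of_ne A h).1) (inShape_of_ne A h).2.1
  · exact absurd (hab.2 (inShape_of_ne A h).1) (inShape_of_ne A h).2.1

theorem Linked.ne_zero {A : conormalFiber k l lam} {a b : Fin (k + l)} (h : Linked A a b)
    (ha : a ∈ indexSet k l lam) (hb : b ∉ indexSet k l lam) : A.1 a b ≠ 0 := by
  rcases h with rfl | h | h
  · exact absurd ha hb
  · exact h
  · exact absurd (inShape_of_ne A h).1 hb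

/-- For two different uncovered positions `u` and `v` there is a set of indices that is compatible
with all non-zero entries of `A` and with `v`, and contains the row but not the column of `u`. -/
theorem exists_separating_set {A : conormalFiber k l lam} (hA : IsRook A)
    {u v : UncoveredPos A} (huv : u ≠ v) :
    ∃ D : Set (Fin (k + l)), (∀ i j, A.1 i j ≠ 0 → (i ∈ D ↔ j ∈ D)) ∧
      (v.1.1 ∈ D ↔ v.1.2 ∈ D) ∧ u.1.1 ∈ D ∧ u.1.2 ∉ D := by
  obtain ⟨⟨i₁, j₁⟩, hu, hul, hub⟩ := u
  obtain ⟨⟨i₂, j₂⟩, hv, hvl, hvb⟩ := v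
  simp only at hu hul hub hv hvl hvb ⊢
  have hne : ¬ (i₁ = i₂ ∧ j₁ = j₂) := by
    rintro ⟨rfl, rfl⟩
    exact huv rfl
  have hu0 : A.1 i₁ j₁ = 0 := hul j₁ le_rfl
  -- This is the connected component of `i₁` in the graph whose edges are the non-zero entries of
  -- `A` together with `v`.
  let D : Set (Fin (k + l)) := {x | Linked A x i₁ ∨
    ((Linked A i₂ i₁ ∨ Linked A j₂ i₁) ∧ (Linked A x i₂ ∨ Linked A x j₂))}
  have hlink : ∀ x y, Linked A x y → y ∈ D → x ∈ D := by
    rintro x y hxy (h | ⟨h, h' | h'⟩)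
    · exact Or.inl (hxy.trans hA h)
    · exact Or.inr ⟨h, Or.inl (hxy.trans hA h')⟩
    · exact Or.inr ⟨h, Or.inr (hxy.trans hA h')⟩
  refine ⟨D, fun i j hij => ⟨fun h => ?_, fun h => ?_⟩, ⟨fun h => ?_, fun h => ?_⟩, ?_, ?_⟩
  · exact hlink j i (Or.inr (Or.inr hij)) h
  · exact hlink i j (Or.inr (Or.inl hij)) h
  · rcases h with h | ⟨h, -⟩
    · exact Or.inr ⟨Or.inl h, Or.inr (Or.inl rfl)⟩
    · exact Or.inr ⟨h, Or.inr (Or.inl rfl)⟩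
  · rcases h with h | ⟨h, -⟩
    · exact Or.inr ⟨Or.inr h, Or.inl (Or.inl rfl)⟩
    · exact Or.inr ⟨h, Or.inl (Or.inl rfl)⟩
  · exact Or.inl (Or.inl rfl)
  · have hnot : ¬ Linked A j₁ i₁ := fun h => h.symm.ne_zero hu.1 hu.2.1 hu0
    rintro (h | ⟨h | h, h' | h'⟩)
    · exact hnot h
    · exact hnot (h'.trans hA h)
    · exact hne ⟨(h.eq_of_mem (iff_of_true hv.1 hu.1)).symm,
        h'.eq_of_mem (iff_of_false hu.2.1 hv.2.1)⟩
    -- The only way to connect `i₁` with `j₁` is the cycle through `(i₁, j₂)` and `(i₂, j₁)`. As `u`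
    -- is uncovered, the first entry forces `j₁ < j₂`; then the second lies to the left of `v`,
    -- which is uncovered too.
    · have h1 : A.1 i₁ j₂ ≠ 0 := h.symm.ne_zero hu.1 hv.2.1
      have h2 : A.1 i₂ j₁ ≠ 0 := h'.symm.ne_zero hv.1 hu.2.1
      have hj : j₁ < j₂ := by
        by_contra hle
        exact h1 (hul j₂ (not_lt.1 hle))
      exact h2 (hvl j₁ hj.le)
    · exact hnot (h'.trans hA h)

open Classical in
/-- The torus rescales one slice coordinate without changing the other. -/
theorem rescale_mem_orbit {A : conormalFiber k l lam} (hA : IsRook A)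
    (e : Fin 2 ≃ UncoveredPos A) {s t : Fin 2} (hst : s ≠ t) {y z : Fin 2 → ℂ}
    (hs : y s = 0 ↔ z s = 0) (ht : y t = z t) :
    A + slicePart e y ∈ MulAction.orbit (borelStab k l lam) (A + slicePart e z) := by
  obtain ⟨D, hD, hDv, hu1, hu2⟩ := exists_separating_set hA (e.injective.ne hst)
  obtain ⟨α, hα, hαy⟩ : ∃ α : ℂ, α ≠ 0 ∧ y s = α * z s := by
    by_cases h0 : y s = 0
    · exact ⟨1, one_ne_zero, by rw [h0, hs.1 h0, mul_zero]⟩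
    · have hz : z s ≠ 0 := fun h => h0 (hs.2 h)
      exact ⟨y s / z s, div_ne_zero h0 hz, by field_simp⟩
  -- A diagonal matrix scales entry `(i, j)` by `t i / t j`. With `t = α` on `D` and `1` elsewhere,
  -- only the position of `s` is scaled among the entries in use.
  refine mem_orbit_of_diagonal (t := fun x => if x ∈ D then α else 1) (fun x => ?_) fun i j => ?_
  · split_ifs
    · exact hα
    · exact one_ne_zero
  change (A.1 i j + (slicePart e y).1 i j) * _ = _ * (A.1 i j + (slicePart e z).1 i j)
  by_cases hU : Uncovered A i j
  · have h0 : A.1 i j = 0 := hU.2.1 j le_rfl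
    obtain ⟨r, hr⟩ := e.surjective ⟨(i, j), hU⟩
    have hi : i = (e r).1.1 := by rw [hr]
    have hj : j = (e r).1.2 := by rw [hr]
    have hrst : r = s ∨ r = t := by omega
    rw [h0, zero_add, zero_add, hi, hj, slicePart_apply, slicePart_apply]
    rcases hrst with rfl | rfl
    · rw [if_pos hu1, if_neg hu2, mul_one, hαy]
    · rw [ht]
      by_cases h : (e r).1.1 ∈ D
      · rw [if_pos h, if_pos (hDv.1 h), mul_comm]
      · rw [if_neg h, if_neg (mt hDv.2 h), mul_comm]
  · rw [slicePart_apply_of_not e y hU, slicePart_apply_of_not e z hU, add_zero]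
    by_cases h0 : A.1 i j = 0
    · rw [h0, zero_mul, mul_zero]
    · by_cases h : i ∈ D
      · rw [if_pos h, if_pos ((hD i j h0).1 h), mul_comm]
      · rw [if_neg h, if_neg (mt (hD i j h0).2 h), mul_comm]

/-- Points of a two-dimensional slice in the same coordinate stratum are in the same orbit. -/
theorem mem_orbit_of_same_stratum {A : conormalFiber k l lam} (hA : IsRook A)
    (e : Fin 2 ≃ UncoveredPos A) {y z : Fin 2 → ℂ} (h : ∀ s, y s = 0 ↔ z s = 0) :
    A + slicePart e y ∈ MulAction.orbit (borelStab k l lam) (A + slicePart e z) := by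
  have h1 : A + slicePart e y ∈ MulAction.orbit (borelStab k l lam)
      (A + slicePart e ![z 0, y 1]) :=
    rescale_mem_orbit hA e (s := 0) (t := 1) (by decide) (by simpa using h 0) (by simp)
  have h2 : A + slicePart e ![z 0, y 1] ∈ MulAction.orbit (borelStab k l lam)
      (A + slicePart e z) :=
    rescale_mem_orbit hA e (s := 1) (t := 0) (by decide) (by simpa using h 1) (by simp)
  rwa [MulAction.orbit_eq_iff.2 h2] at h1

/-! ### Codimension of orbits and the plane slice. -/

/-- The codimension of the orbit of a rook matrix is the number of uncovered positions. -/
theorem isSmoothAt_orbit_of_isRook {A : conormalFiber k l lam} (hA : IsRook A) {c : ℕ}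
    (e : Fin c ≃ UncoveredPos A) :
    IsSmoothAt (MulAction.orbit (borelStab k l lam) A) c A := by
  obtain ⟨f, hf, hs, -, hmem⟩ := exists_sliceProj hA e
  refine ⟨MulAction.mem_orbit_self A, f, hf, hs, ?_⟩
  have hzero : A + slicePart e 0 = A := by rw [slicePart_zero, add_zero]
  filter_upwards [hmem] with B hB
  constructor
  · intro h
    refine eq_zero_of_mem_orbit e ?_
    rw [hzero, ← MulAction.orbit_eq_iff] at *
    rw [← hB, h]
  · intro h
    rwa [h, hzero] at hB

/-- Uniqueness of codimension turns the analytic hypothesis into the combinatorial one: exactly two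
positions are uncovered. -/
theorem exists_isPlaneSlice {A : conormalFiber k l lam} (hA : IsRook A)
    (hcodim : HasCodim (MulAction.orbit (borelStab k l lam) A) 2) :
    ∃ f q, IsPlaneSlice (borelStab k l lam) A f q := by
  obtain ⟨c, ⟨e'⟩⟩ := Finite.exists_equiv_fin (UncoveredPos A)
  obtain rfl : c = 2 := (isSmoothAt_orbit_of_isRook hA e'.symm).codim_unique
    (hcodim A (MulAction.mem_orbit_self A))
  obtain ⟨f, hf, hs, hf0, hmem⟩ := exists_sliceProj hA e'.symm
  exact ⟨f, fun y => A + slicePart e'.symm y, hf, hs, hf0, hmem,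
    fun y z h => mem_orbit_of_same_stratum hA _ h, fun y h => eq_zero_of_mem_orbit _ h,
    single_not_mem_orbit _ (by decide)⟩

end GrassmannConormal

end

theorem theorem2p6p1 (k l : ℕ) (lam : YoungDiagram) (hlam : FitsIn k l lam)
    (O : Set (conormalFiber k l lam)) (hO : IsOrbit O) (hcodim : HasCodim O 2) :
    ((codimOneOrbitsAbove O).ncard = 1 ∨ (codimOneOrbitsAbove O).ncard = 2) ∧
    (∀ O' ∈ codimOneOrbitsAbove O, ∀ p ∈ O, IsSmoothAt (closure O') 1 p) ∧
    (∀ O₁ ∈ codimOneOrbitsAbove O, ∀ O₂ ∈ codimOneOrbitsAbove O, O₁ ≠ O₂ → ∀ p ∈ O,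
      TransverseAt (closure O₁) (closure O₂) p ∧
      NormalCrossingsAt (closure O₁) (closure O₂) p) := by
  obtain ⟨A, rfl⟩ := hO
  obtain ⟨B, hB, hrook⟩ := exists_isRook_mem_orbit A
  rw [← MulAction.orbit_eq_iff.2 hB] at hcodim ⊢
  obtain ⟨f, q, h⟩ := exists_isPlaneSlice hrook hcodim
  exact codim_one_orbits_of_isPlaneSlice actsLinearly_borelStab h hcodim _ fun _ => Iff.rfl
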